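/- All C*-algebras are complex, and $\otimes$ denotes the minimal (spatial) tensor product. A unital C*-algebra $D$ is *strongly self-absorbing* if $D\not\cong\mathbb{C}$ and there are a $*$-isomorphism $\varphi: D\to D\otimes D$ and a sequence of unitaries $u_n\in D\otimes D$ with $\|u_n\varphi(d)u_n^*-d\otimes 1_D\|\to 0$ for every $d\in D$. It is *quasidiagonal* if it has a faithful representation $\pi: D\to B(H)$ on a Hilbert space such that for all finite sets $F\subset D$, $V\subset H$ and every $\varepsilon>0$ there is a finite rank projection $P\in B(H)$ with $\|P\pi(d)-\pi(d)P\|<\varepsilon$ for $d\in F$ and $\|P\xi-\xi\|<\varepsilon$ for $\xi\in V$. It has *cancellation of projections* if, for all projections $p,q,r$ in matrix algebras over $D$, Murray–von Neumann equivalence $p\oplus r\sim q\oplus r$ implies $p\sim q$. Let $K_0(D)^+\subset K_0(D)$ be the set of classes of projections in matrix algebras over $D$. The *universal UHF algebra* $\mathcal{Q}$ is the inductive limit of the matrix algebras $M_{n!}(\mathbb{C})$, $n\ge 1$, under unital embeddings. **Proposition.** Let $D$ be a nonzero, separable, unital and strongly self-absorbing C*-algebra. If $D$ is quasidiagonal,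 has cancellation of projections, and $[1_D]\in nK_0(D)^+$ for all integers $n\ge 1$, then $D$ is $*$-isomorphic to $\mathcal{Q}$. -/

import Mathlib

open Filter Topology
open scoped TensorProduct Matrix InnerProductSpace

universe u v

noncomputable section

/-! ### Approximate unitary equivalence -/

/-- Two unital `*`-homomorphisms `σ, γ : A → B` of C*-algebras are approximately unitarily
equivalent if there is a sequence of unitaries `w n` of `B` with
`‖w n * σ a * (w n)* - γ a‖ → 0` for every `a`. -/
def ApproxUnitarilyEquiv {A : Type u} {B : Type v} [CStarAlgebra A] [CStarAlgebra B]
    (σ γ : A →⋆ₐ[ℂ] B) : Prop :=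
  ∃ w : ℕ → unitary B, ∀ a : A,
    Tendsto (fun n => ‖(w n : B) * σ a * star (w n : B) - γ a‖) atTop (𝓝 0)

/-! ### The spatial (minimal) tensor product -/

section Operators

variable {H : Type*} [NormedAddCommGroup H] [InnerProductSpace ℂ H]
variable {K : Type*} [NormedAddCommGroup K] [InnerProductSpace ℂ K]

/-- The Hilbert space tensor product: the completion of the algebraic tensor product for the
inner product with `⟪a ⊗ b, c ⊗ d⟫ = ⟪a, c⟫ * ⟪b, d⟫`. -/
def HilbertTensor (H K : Type*) [NormedAddCommGroup H] [InnerProductSpace ℂ H]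
    [NormedAddCommGroup K] [InnerProductSpace ℂ K] : Type _ :=
  UniformSpace.Completion (H ⊗[ℂ] K)

instance HilbertTensor.normedAddCommGroup : NormedAddCommGroup (HilbertTensor H K) :=
  inferInstanceAs (NormedAddCommGroup (UniformSpace.Completion (H ⊗[ℂ] K)))

instance HilbertTensor.innerProductSpace : InnerProductSpace ℂ (HilbertTensor H K) :=
  inferInstanceAs (InnerProductSpace ℂ (UniformSpace.Completion (H ⊗[ℂ] K)))

instance HilbertTensor.completeSpace : CompleteSpace (HilbertTensor H K) :=
  inferInstanceAs (CompleteSpace (UniformSpace.Completion (H ⊗[ℂ] K)))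

/-- The inclusion of the algebraic tensor product into the Hilbert space tensor product. -/
def HilbertTensor.incl : H ⊗[ℂ] K →L[ℂ] HilbertTensor H K :=
  UniformSpace.Completion.toComplL (𝕜 := ℂ) (E := H ⊗[ℂ] K)

theorem HilbertTensor.denseRange_incl : DenseRange (HilbertTensor.incl : H ⊗[ℂ] K →L[ℂ] _) :=
  UniformSpace.Completion.denseRange_coe

theorem HilbertTensor.inner_incl (x y : H ⊗[ℂ] K) :
    inner ℂ (HilbertTensor.incl x) (HilbertTensor.incl y) = inner ℂ x y :=
  UniformSpace.Completion.inner_coe x y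

/-- The bounded operator `S ⊗ T` on the Hilbert space tensor product, the continuous extension of
`a ⊗ b ↦ S a ⊗ T b`. -/
def opTensor (S : H →L[ℂ] H) (T : K →L[ℂ] K) : HilbertTensor H K →L[ℂ] HilbertTensor H K :=
  ContinuousLinearMap.completion (TensorProduct.mapL S T)

theorem opTensor_incl (S : H →L[ℂ] H) (T : K →L[ℂ] K) (x : H ⊗[ℂ] K) :
    opTensor S T (HilbertTensor.incl x) = HilbertTensor.incl (TensorProduct.mapL S T x) :=
  ContinuousLinearMap.completion_apply_coe _ _

theorem HilbertTensor.op_ext {S T : HilbertTensor H K →L[ℂ] HilbertTensor H K}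
    (h : ∀ x : H ⊗[ℂ] K, S (HilbertTensor.incl x) = T (HilbertTensor.incl x)) : S = T :=
  DFunLike.coe_injective (HilbertTensor.denseRange_incl.equalizer S.continuous
    T.continuous (funext h))

theorem opTensor_mul (S S' : H →L[ℂ] H) (T T' : K →L[ℂ] K) :
    opTensor (S * S') (T * T') = opTensor S T * opTensor S' T' := by
  refine HilbertTensor.op_ext fun x => ?_
  rw [mul_apply_eq_comp, opTensor_incl, opTensor_incl, opTensor_incl,
    TensorProduct.mapL_mul, mul_apply_eq_comp]

theorem opTensor_one : opTensor (1 : H →L[ℂ] H) (1 : K →L[ℂ] K) = 1 := by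
  refine HilbertTensor.op_ext fun x => ?_
  rw [opTensor_incl]
  simp [ContinuousLinearMap.one_def]

theorem opTensor_add_left (S S' : H →L[ℂ] H) (T : K →L[ℂ] K) :
    opTensor (S + S') T = opTensor S T + opTensor S' T := by
  refine HilbertTensor.op_ext fun x => ?_
  rw [add_apply, opTensor_incl, opTensor_incl, opTensor_incl,
    TensorProduct.mapL_add_left, add_apply, map_add]

theorem opTensor_smul_left (c : ℂ) (S : H →L[ℂ] H) (T : K →L[ℂ] K) :
    opTensor (c • S) T = c • opTensor S T := by
  refine HilbertTensor.op_ext fun x => ?_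
  rw [smul_apply, opTensor_incl, opTensor_incl,
    TensorProduct.mapL_smul_left, smul_apply, map_smul]

theorem inner_mapL_adjoint [CompleteSpace H] [CompleteSpace K]
    (S : H →L[ℂ] H) (T : K →L[ℂ] K) (x y : H ⊗[ℂ] K) :
    inner ℂ (TensorProduct.mapL (star S) (star T) x) y = inner ℂ x (TensorProduct.mapL S T y) := by
  induction x with
  | zero => simp
  | add x₁ x₂ h₁ h₂ => rw [map_add, inner_add_left, inner_add_left, h₁, h₂]
  | tmul a b =>
    induction y with
    | zero => simp
    | add y₁ y₂ h₁ h₂ => rw [map_add, inner_add_right, inner_add_right, h₁, h₂]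
    | tmul c d =>
      simp only [TensorProduct.mapL_tmul, TensorProduct.inner_tmul,
        ContinuousLinearMap.star_eq_adjoint, ContinuousLinearMap.adjoint_inner_left]

theorem opTensor_star [CompleteSpace H] [CompleteSpace K] (S : H →L[ℂ] H) (T : K →L[ℂ] K) :
    opTensor (star S) (star T) = star (opTensor S T) := by
  rw [ContinuousLinearMap.star_eq_adjoint (opTensor S T), ContinuousLinearMap.eq_adjoint_iff]
  intro x y
  refine HilbertTensor.denseRange_incl.induction_on₂ (p := fun x y =>
    inner ℂ (opTensor (star S) (star T) x) y = inner ℂ x (opTensor S T y)) ?_ ?_ x y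
  · apply isClosed_eq
    · exact ((opTensor _ _).continuous.comp continuous_fst).inner continuous_snd
    · exact continuous_fst.inner ((opTensor _ _).continuous.comp continuous_snd)
  · intro x y
    rw [opTensor_incl, opTensor_incl, HilbertTensor.inner_incl, HilbertTensor.inner_incl,
      inner_mapL_adjoint]

/-- The ampliation `S ↦ S ⊗ 1`, as a unital `*`-homomorphism. -/
def ampliation (H K : Type*) [NormedAddCommGroup H] [InnerProductSpace ℂ H] [CompleteSpace H]
    [NormedAddCommGroup K] [InnerProductSpace ℂ K] [CompleteSpace K] :
    (H →L[ℂ] H) →⋆ₐ[ℂ] (HilbertTensor H K →L[ℂ] HilbertTensor H K) where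
  toFun S := opTensor S 1
  map_one' := opTensor_one
  map_mul' S S' := by rw [← opTensor_mul, one_mul]
  map_zero' := by simpa using opTensor_smul_left (0 : ℂ) (0 : H →L[ℂ] H) (1 : K →L[ℂ] K)
  map_add' S S' := opTensor_add_left S S' 1
  commutes' c := by
    rw [Algebra.algebraMap_eq_smul_one, opTensor_smul_left, opTensor_one,
      ← Algebra.algebraMap_eq_smul_one]
  map_star' S := by rw [← opTensor_star, star_one]

end Operators

section Spatial

variable {A : Type*} {B : Type*} [CStarAlgebra A] [CStarAlgebra B]
variable {H : Type*} [NormedAddCommGroup H] [InnerProductSpace ℂ H] [CompleteSpace H]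
variable {K : Type*} [NormedAddCommGroup K] [InnerProductSpace ℂ K] [CompleteSpace K]

/-- The spatial tensor product of the represented C*-algebras `π : A → B(H)` and `ρ : B → B(K)`:
the C*-algebra of operators on `H ⊗ K` generated by the operators `π a ⊗ ρ b`. For faithful `π`
and `ρ` this is the minimal C*-tensor product `A ⊗ B`, and up to the canonical isomorphism it does
not depend on the choice of the faithful representations. -/
def spatialTensor (π : A →⋆ₐ[ℂ] (H →L[ℂ] H)) (ρ : B →⋆ₐ[ℂ] (K →L[ℂ] K)) :
    StarSubalgebra ℂ (HilbertTensor H K →L[ℂ] HilbertTensor H K) :=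
  (StarAlgebra.adjoin ℂ
    (Set.range fun x : A × B => opTensor (π x.1) (ρ x.2))).topologicalClosure

instance spatialTensor_cstarAlgebra (π : A →⋆ₐ[ℂ] (H →L[ℂ] H)) (ρ : B →⋆ₐ[ℂ] (K →L[ℂ] K)) :
    CStarAlgebra (spatialTensor π ρ) :=
  StarSubalgebra.cstarAlgebra (spatialTensor π ρ)
    (h_closed := StarSubalgebra.isClosed_topologicalClosure _)

theorem opTensor_mem_spatialTensor (π : A →⋆ₐ[ℂ] (H →L[ℂ] H)) (ρ : B →⋆ₐ[ℂ] (K →L[ℂ] K))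
    (a : A) (b : B) : opTensor (π a) (ρ b) ∈ spatialTensor π ρ :=
  StarSubalgebra.le_topologicalClosure _ (StarAlgebra.subset_adjoin ℂ _ ⟨(a, b), rfl⟩)

/-- The first-factor embedding `a ↦ a ⊗ 1` of `A` into `A ⊗ B`. -/
def spatialInl (π : A →⋆ₐ[ℂ] (H →L[ℂ] H)) (ρ : B →⋆ₐ[ℂ] (K →L[ℂ] K)) :
    A →⋆ₐ[ℂ] spatialTensor π ρ :=
  ((ampliation H K).comp π).codRestrict (spatialTensor π ρ) fun a => by
    have h := opTensor_mem_spatialTensor π ρ a 1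
    rw [map_one] at h
    exact h

end Spatial

/-! ### Strongly self-absorbing and quasidiagonal C*-algebras -/

/-- A unital C*-algebra `D` is strongly self-absorbing if `D ≠ ℂ` and there is an isomorphism
`φ : D → D ⊗ D` (minimal tensor product) which is approximately unitarily equivalent to
`d ↦ d ⊗ 1`. -/
def IsStronglySelfAbsorbing (D : Type u) [CStarAlgebra D] : Prop :=
  IsEmpty (D ≃⋆ₐ[ℂ] ℂ) ∧
  ∃ (H : Type u) (_ : NormedAddCommGroup H) (_ : InnerProductSpace ℂ H) (_ : CompleteSpace H)
    (K : Type u) (_ : NormedAddCommGroup K) (_ : InnerProductSpace ℂ K) (_ : CompleteSpace K)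
    (π : D →⋆ₐ[ℂ] (H →L[ℂ] H)) (ρ : D →⋆ₐ[ℂ] (K →L[ℂ] K)),
    Function.Injective π ∧ Function.Injective ρ ∧
    ∃ φ : D ≃⋆ₐ[ℂ] spatialTensor π ρ,
      ApproxUnitarilyEquiv (φ : D →⋆ₐ[ℂ] spatialTensor π ρ) (spatialInl π ρ)

/-- A set `S` of bounded operators on a Hilbert space `H` is quasidiagonal if for every finite
subset `F` of `S`, every finite set `V` of vectors and every `ε > 0` there is a finite rank
projection `P` with `‖P T - T P‖ < ε` for `T ∈ F` and `‖P ξ - ξ‖ < ε` for `ξ ∈ V`. -/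
def IsQuasidiagonalSet {H : Type*} [NormedAddCommGroup H] [InnerProductSpace ℂ H]
    [CompleteSpace H] (S : Set (H →L[ℂ] H)) : Prop :=
  ∀ (F : Finset (H →L[ℂ] H)) (V : Finset H) (ε : ℝ), (F : Set (H →L[ℂ] H)) ⊆ S → 0 < ε →
    ∃ P : H →L[ℂ] H, IsStarProjection P ∧ FiniteDimensional ℂ (LinearMap.range P.toLinearMap) ∧
      (∀ T ∈ F, ‖P * T - T * P‖ < ε) ∧ ∀ ξ ∈ V, ‖P ξ - ξ‖ < ε

/-- A unital C*-algebra is quasidiagonal if it has a faithful (unital) representation on a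
Hilbert space whose image is a quasidiagonal set of operators. -/
def IsQuasidiagonal (D : Type u) [CStarAlgebra D] : Prop :=
  ∃ (H : Type u) (_ : NormedAddCommGroup H) (_ : InnerProductSpace ℂ H) (_ : CompleteSpace H)
    (π : D →⋆ₐ[ℂ] (H →L[ℂ] H)), Function.Injective π ∧ IsQuasidiagonalSet (Set.range π)

/-! ### Projections in matrix algebras, the monoid `V(D)` and the ordered group `K₀(D)` -/

section KTheory

/-- Murray-von Neumann equivalence of projections in (possibly different) matrix algebras over `D`:
`p ∼ q` if `p = v* v` and `q = v v*` for a rectangular matrix `v` over `D`. -/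
def MurrayVonNeumann {D : Type*} [Ring D] [StarRing D] {m n : Type*} [Fintype m] [Fintype n]
    (p : Matrix m m D) (q : Matrix n n D) : Prop :=
  ∃ w : Matrix n m D, wᴴ * w = p ∧ w * wᴴ = q

namespace MurrayVonNeumann

variable {D : Type*} [Ring D] [StarRing D]
variable {l m n k : Type*} [Fintype l] [Fintype m] [Fintype n] [Fintype k]

theorem refl {p : Matrix m m D} (hp : IsStarProjection p) : MurrayVonNeumann p p := by
  have h₁ : p * p = p := hp.isIdempotentElem
  have h₂ : pᴴ = p := hp.isSelfAdjoint
  exact ⟨p, by rw [h₂, h₁], by rw [h₂, h₁]⟩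

theorem symm {p : Matrix m m D} {q : Matrix n n D} (h : MurrayVonNeumann p q) :
    MurrayVonNeumann q p := by
  obtain ⟨w, hp, hq⟩ := h
  exact ⟨wᴴ, by rwa [Matrix.conjTranspose_conjTranspose],
    by rwa [Matrix.conjTranspose_conjTranspose]⟩

theorem trans {p : Matrix l l D} {q : Matrix m m D} {r : Matrix n n D}
    (hp : IsStarProjection p) (hr : IsStarProjection r)
    (h : MurrayVonNeumann p q) (h' : MurrayVonNeumann q r) : MurrayVonNeumann p r := by
  obtain ⟨a, ha, ha'⟩ := h
  obtain ⟨b, hb, hb'⟩ := h'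
  refine ⟨b * a, ?_, ?_⟩
  · calc (b * a)ᴴ * (b * a) = aᴴ * (bᴴ * b) * a := by
          simp only [Matrix.conjTranspose_mul, Matrix.mul_assoc]
      _ = (aᴴ * a) * (aᴴ * a) := by rw [hb, ← ha']; simp only [Matrix.mul_assoc]
      _ = p := by rw [ha]; exact hp.isIdempotentElem
  · calc (b * a) * (b * a)ᴴ = b * (a * aᴴ) * bᴴ := by
          simp only [Matrix.conjTranspose_mul, Matrix.mul_assoc]
      _ = (b * bᴴ) * (b * bᴴ) := by rw [ha', ← hb]; simp only [Matrix.mul_assoc]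
      _ = r := by rw [hb']; exact hr.isIdempotentElem

theorem reindex (e : m ≃ n) {p : Matrix m m D} (hp : IsStarProjection p) :
    MurrayVonNeumann p (p.submatrix e.symm e.symm) := by
  have h₁ : p * p = p := hp.isIdempotentElem
  have h₂ : pᴴ = p := hp.isSelfAdjoint
  refine ⟨p.submatrix e.symm id, ?_, ?_⟩
  · rw [Matrix.conjTranspose_submatrix, h₂, Matrix.submatrix_mul_equiv p p id e.symm id, h₁,
      Matrix.submatrix_id_id]
  · rw [Matrix.conjTranspose_submatrix, h₂,
      ← Matrix.submatrix_mul p p e.symm id e.symm Function.bijective_id, h₁]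

theorem fromBlocks {p : Matrix l l D} {p' : Matrix m m D} {q : Matrix n n D} {q' : Matrix k k D}
    (h : MurrayVonNeumann p p') (h' : MurrayVonNeumann q q') :
    MurrayVonNeumann (Matrix.fromBlocks p 0 0 q) (Matrix.fromBlocks p' 0 0 q') := by
  obtain ⟨a, ha, ha'⟩ := h
  obtain ⟨b, hb, hb'⟩ := h'
  refine ⟨Matrix.fromBlocks a 0 0 b, ?_, ?_⟩
  · simp [Matrix.fromBlocks_conjTranspose, Matrix.fromBlocks_multiply, ha, hb]
  · simp [Matrix.fromBlocks_conjTranspose, Matrix.fromBlocks_multiply, ha', hb']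

end MurrayVonNeumann

theorem IsStarProjection.matrix_fromBlocks {D : Type*} [Ring D] [StarRing D] {m n : Type*}
    [Fintype m] [Fintype n] {p : Matrix m m D} {q : Matrix n n D} (hp : IsStarProjection p)
    (hq : IsStarProjection q) : IsStarProjection (Matrix.fromBlocks p 0 0 q) := by
  have h₁ : p * p = p := hp.isIdempotentElem
  have h₂ : pᴴ = p := hp.isSelfAdjoint
  have h₃ : q * q = q := hq.isIdempotentElem
  have h₄ : qᴴ = q := hq.isSelfAdjoint
  constructor
  · simp [IsIdempotentElem, Matrix.fromBlocks_multiply, h₁, h₃]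
  · simp [IsSelfAdjoint, Matrix.star_eq_conjTranspose, Matrix.fromBlocks_conjTranspose, h₂, h₄]

theorem IsStarProjection.matrix_submatrix {D : Type*} [Ring D] [StarRing D] {m n : Type*}
    [Fintype m] [Fintype n] {p : Matrix m m D} (hp : IsStarProjection p) (e : n ≃ m) :
    IsStarProjection (p.submatrix e e) := by
  have h₁ : p * p = p := hp.isIdempotentElem
  have h₂ : pᴴ = p := hp.isSelfAdjoint
  constructor
  · rw [IsIdempotentElem, Matrix.submatrix_mul_equiv, h₁]
  · rw [IsSelfAdjoint, Matrix.star_eq_conjTranspose, Matrix.conjTranspose_submatrix, h₂]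

/-- Projections in the matrix algebras `M_n(D)`, `n ≥ 0`. -/
structure MatrixProjection (D : Type u) [Ring D] [StarRing D] : Type u where
  /-- The size of the matrix. -/
  size : ℕ
  /-- The matrix. -/
  mat : Matrix (Fin size) (Fin size) D
  /-- The matrix is a projection. -/
  isProj : IsStarProjection mat

variable (D : Type u) [Ring D] [StarRing D]

/-- Murray-von Neumann equivalence on the projections in matrix algebras over `D`. -/
instance MatrixProjection.setoid : Setoid (MatrixProjection D) where
  r p q := MurrayVonNeumann p.mat q.mat
  iseqv :=
    { refl := fun p => MurrayVonNeumann.refl p.isProj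
      symm := fun h => h.symm
      trans := fun {p _ r} h h' => MurrayVonNeumann.trans p.isProj r.isProj h h' }

/-- The block diagonal sum `p ⊕ q`. -/
def MatrixProjection.directSum {D : Type u} [Ring D] [StarRing D] (p q : MatrixProjection D) :
    MatrixProjection D where
  size := p.size + q.size
  mat := (Matrix.fromBlocks p.mat 0 0 q.mat).submatrix finSumFinEquiv.symm finSumFinEquiv.symm
  isProj := (p.isProj.matrix_fromBlocks q.isProj).matrix_submatrix finSumFinEquiv.symm

/-- The projection `0` of size `0`. -/
def MatrixProjection.empty : MatrixProjection D where
  size := 0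
  mat := 0
  isProj := .zero _

/-- The unit of `D`, as a `1 × 1` matrix. -/
def MatrixProjection.unit : MatrixProjection D where
  size := 1
  mat := 1
  isProj := .one _

/-- The Murray-von Neumann monoid `V(D)` of equivalence classes of projections in matrix algebras
over `D`. -/
def MurrayVonNeumannMonoid : Type u := Quotient (MatrixProjection.setoid D)

variable {D}

theorem MatrixProjection.directSum_equiv (p q : MatrixProjection D) :
    MurrayVonNeumann (Matrix.fromBlocks p.mat 0 0 q.mat) (p.directSum q).mat :=
  MurrayVonNeumann.reindex finSumFinEquiv (p.isProj.matrix_fromBlocks q.isProj)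

theorem MatrixProjection.directSum_congr {p p' q q' : MatrixProjection D} (h : p ≈ p')
    (h' : q ≈ q') : p.directSum q ≈ p'.directSum q' :=
  have hp := p.isProj.matrix_fromBlocks q.isProj
  (p.directSum_equiv q).symm.trans (p.directSum q).isProj (p'.directSum q').isProj
    ((MurrayVonNeumann.fromBlocks h h').trans hp (p'.directSum q').isProj
      (p'.directSum_equiv q'))

theorem MatrixProjection.directSum_comm (p q : MatrixProjection D) :
    p.directSum q ≈ q.directSum p := by
  have hp := p.isProj.matrix_fromBlocks q.isProj
  have hq := q.isProj.matrix_fromBlocks p.isProj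
  refine (p.directSum_equiv q).symm.trans (p.directSum q).isProj (q.directSum p).isProj
    (MurrayVonNeumann.trans hp (q.directSum p).isProj ?_ (q.directSum_equiv p))
  have h := MurrayVonNeumann.reindex (Equiv.sumComm _ _) hp
  rwa [Equiv.sumComm_symm, Equiv.sumComm_apply, Matrix.fromBlocks_submatrix_sum_swap_sum_swap] at h

theorem MatrixProjection.directSum_assoc (p q r : MatrixProjection D) :
    (p.directSum q).directSum r ≈ p.directSum (q.directSum r) := by
  have hpq := p.isProj.matrix_fromBlocks q.isProj
  have hqr := q.isProj.matrix_fromBlocks r.isProj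
  have hl := hpq.matrix_fromBlocks r.isProj
  have hr := p.isProj.matrix_fromBlocks hqr
  have h₁ : MurrayVonNeumann (Matrix.fromBlocks (Matrix.fromBlocks p.mat 0 0 q.mat) 0 0 r.mat)
      ((p.directSum q).directSum r).mat :=
    (MurrayVonNeumann.fromBlocks (p.directSum_equiv q) (.refl r.isProj)).trans hl
      ((p.directSum q).directSum r).isProj ((p.directSum q).directSum_equiv r)
  have h₂ : MurrayVonNeumann (Matrix.fromBlocks p.mat 0 0 (Matrix.fromBlocks q.mat 0 0 r.mat))
      (p.directSum (q.directSum r)).mat :=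
    (MurrayVonNeumann.fromBlocks (.refl p.isProj) (q.directSum_equiv r)).trans hr
      (p.directSum (q.directSum r)).isProj (p.directSum_equiv (q.directSum r))
  have h := MurrayVonNeumann.reindex (Equiv.sumAssoc _ _ _) hl
  have e : (Matrix.fromBlocks (Matrix.fromBlocks p.mat 0 0 q.mat) 0 0 r.mat).submatrix
      (Equiv.sumAssoc _ _ _).symm (Equiv.sumAssoc _ _ _).symm =
      Matrix.fromBlocks p.mat 0 0 (Matrix.fromBlocks q.mat 0 0 r.mat) := by
    ext (i | i | i) (j | j | j) <;> rfl
  rw [e] at h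
  exact h₁.symm.trans ((p.directSum q).directSum r).isProj
    (p.directSum (q.directSum r)).isProj
    (h.trans hl (p.directSum (q.directSum r)).isProj h₂)

theorem MatrixProjection.empty_directSum (p : MatrixProjection D) :
    (MatrixProjection.empty D).directSum p ≈ p := by
  have h₀ := (MatrixProjection.empty D).isProj.matrix_fromBlocks p.isProj
  have h : MurrayVonNeumann (Matrix.fromBlocks (MatrixProjection.empty D).mat 0 0 p.mat) p.mat :=
    MurrayVonNeumann.reindex (Equiv.emptySum (Fin 0) (Fin p.size)) h₀
  exact ((MatrixProjection.empty D).directSum_equiv p).symm.trans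
    ((MatrixProjection.empty D).directSum p).isProj p.isProj h

instance MurrayVonNeumannMonoid.instZero : Zero (MurrayVonNeumannMonoid D) where
  zero := Quotient.mk _ (MatrixProjection.empty D)

instance MurrayVonNeumannMonoid.instAdd : Add (MurrayVonNeumannMonoid D) where
  add := Quotient.map₂ MatrixProjection.directSum
    fun _ _ h _ _ h' => MatrixProjection.directSum_congr h h'

/-- `V(D)` is a commutative monoid under `[p] + [q] = [p ⊕ q]`. -/
instance MurrayVonNeumannMonoid.addCommMonoid : AddCommMonoid (MurrayVonNeumannMonoid D) where
  add_assoc := by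
    rintro ⟨p⟩ ⟨q⟩ ⟨r⟩
    exact Quotient.sound (p.directSum_assoc q r)
  zero_add := by
    rintro ⟨p⟩
    exact Quotient.sound p.empty_directSum
  add_zero := by
    rintro ⟨p⟩
    exact (Quotient.sound (p.directSum_comm (MatrixProjection.empty D))).trans
      (Quotient.sound p.empty_directSum)
  add_comm := by
    rintro ⟨p⟩ ⟨q⟩
    exact Quotient.sound (p.directSum_comm q)
  nsmul := nsmulRec

variable (D)

/-- The group `K₀(D)` of a unital C*-algebra: the Grothendieck group of `V(D)`. -/
abbrev KZero : Type u := Algebra.GrothendieckAddGroup (MurrayVonNeumannMonoid D)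

variable {D} in
/-- The class `[p]` in `K₀(D)` of a projection `p` in a matrix algebra over `D`. -/
def KZero.classOf (p : MatrixProjection D) : KZero D :=
  Algebra.GrothendieckAddGroup.of (Quotient.mk _ p : MurrayVonNeumannMonoid D)

/-- The positive cone `K₀(D)⁺`: the classes of projections in matrix algebras over `D`. -/
def KZero.positiveCone : Set (KZero D) := Set.range KZero.classOf

/-- `D` has cancellation of projections: `p ⊕ r ∼ q ⊕ r` implies `p ∼ q` for all projections
`p, q, r` in matrix algebras over `D`. -/
def HasCancellationOfProjections : Prop :=
  ∀ p q r : MatrixProjection D,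
    MurrayVonNeumann (p.directSum r).mat (q.directSum r).mat → MurrayVonNeumann p.mat q.mat

end KTheory

/-! ### The universal UHF algebra -/

section UHF

/-- The Hilbert space `ℓ²(ℕ)`. -/
abbrev EllTwo : Type := lp (fun _ : ℕ => ℂ) 2

/-- The standard basis of `ℓ²(ℕ)`. -/
def ellBasis : HilbertBasis ℕ ℂ EllTwo := .ofRepr (LinearIsometryEquiv.refl ℂ EllTwo)

theorem shift_injective (n : ℕ) [NeZero n] (i : Fin n) :
    Function.Injective fun k : ℕ => (i : ℕ) + n * k := fun a b h => by
  have h' : n * a = n * b := Nat.add_left_cancel h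
  exact Nat.eq_of_mul_eq_mul_left (Nat.pos_of_ne_zero (NeZero.ne n)) h'

/-- The isometry of `ℓ²(ℕ)` which maps the basis vector `e k` to `e (i + n * k)`. -/
def shiftIsometry (n : ℕ) [NeZero n] (i : Fin n) : EllTwo →ₗᵢ[ℂ] EllTwo :=
  (ellBasis.orthonormal.comp _ (shift_injective n i)).orthogonalFamily.linearIsometry

theorem shiftIsometry_basis (n : ℕ) [NeZero n] (i : Fin n) (k : ℕ) :
    shiftIsometry n i (ellBasis k) = ellBasis (i + n * k) := by
  have h : ellBasis k = lp.single 2 k (1 : ℂ) := (ellBasis.repr_symm_single k).symm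
  rw [h, shiftIsometry, OrthogonalFamily.linearIsometry_apply_single]
  simp

/-- The operator of `shiftIsometry`. -/
def shiftOp (n : ℕ) [NeZero n] (i : Fin n) : EllTwo →L[ℂ] EllTwo :=
  (shiftIsometry n i).toContinuousLinearMap

theorem ellTwo_op_ext {S T : EllTwo →L[ℂ] EllTwo}
    (h : ∀ k, S (ellBasis k) = T (ellBasis k)) : S = T := by
  refine ContinuousLinearMap.ext_on (s := Set.range ellBasis) ?_ ?_
  · have := ellBasis.dense_span
    rw [Submodule.dense_iff_topologicalClosure_eq_top]
    exact this
  · rintro _ ⟨k, rfl⟩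
    exact h k

theorem shiftOp_basis (n : ℕ) [NeZero n] (i : Fin n) (k : ℕ) :
    shiftOp n i (ellBasis k) = ellBasis (i + n * k) := shiftIsometry_basis n i k

theorem star_shiftOp_basis (n : ℕ) [NeZero n] (i : Fin n) (k : ℕ) :
    star (shiftOp n i) (ellBasis k) = if k % n = i then ellBasis (k / n) else 0 := by
  refine ellBasis.repr.injective (lp.ext (funext fun l => ?_))
  rw [ellBasis.repr_apply_apply, ellBasis.repr_apply_apply, ContinuousLinearMap.star_eq_adjoint,
    ContinuousLinearMap.adjoint_inner_right, shiftOp_basis]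
  have ho := orthonormal_iff_ite.mp ellBasis.orthonormal
  rw [ho]
  have hn : 0 < n := Nat.pos_of_ne_zero (NeZero.ne n)
  have hk := Nat.mod_add_div k n
  split_ifs with h₁ h₂ h₂
  · have : k / n = l := by
      rw [← h₁, Nat.add_mul_div_left _ _ hn, Nat.div_eq_of_lt i.2, zero_add]
    rw [this, ho, if_pos rfl]
  · exact absurd (by rw [← h₁, Nat.add_mul_mod_self_left, Nat.mod_eq_of_lt i.2]) h₂
  · rw [ho, if_neg]
    rintro rfl
    exact h₁ (by rw [← h₂, hk])
  · rw [inner_zero_right]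

theorem star_shiftOp_mul (n : ℕ) [NeZero n] (i j : Fin n) :
    star (shiftOp n i) * shiftOp n j = if i = j then 1 else 0 := by
  refine ellTwo_op_ext fun k => ?_
  have hn : 0 < n := Nat.pos_of_ne_zero (NeZero.ne n)
  rw [mul_apply_eq_comp, shiftOp_basis, star_shiftOp_basis, Nat.add_mul_mod_self_left,
    Nat.mod_eq_of_lt j.2, Nat.add_mul_div_left _ _ hn, Nat.div_eq_of_lt j.2, zero_add]
  by_cases h : i = j
  · rw [if_pos h, if_pos (by rw [h])]; rfl
  · rw [if_neg h, if_neg fun h' => h (Fin.ext h'.symm)]; rfl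

theorem sum_shiftOp_mul_star (n : ℕ) [NeZero n] :
    ∑ i : Fin n, shiftOp n i * star (shiftOp n i) = 1 := by
  refine ellTwo_op_ext fun k => ?_
  have hn : 0 < n := Nat.pos_of_ne_zero (NeZero.ne n)
  rw [sum_apply, Finset.sum_eq_single (⟨k % n, Nat.mod_lt k hn⟩ : Fin n)]
  · rw [mul_apply_eq_comp, star_shiftOp_basis, if_pos rfl, shiftOp_basis]
    simp [Nat.mod_add_div]
  · intro j _ hj
    rw [mul_apply_eq_comp, star_shiftOp_basis, if_neg fun h => hj (Fin.ext h.symm), map_zero]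
  · intro h
    exact absurd (Finset.mem_univ _) h

/-- The unital representation of the matrix algebra `M_n(ℂ)` on `ℓ²(ℕ)` by block diagonal operators
with constant `n × n` blocks: `a` maps `e (j + n * k)` to `∑ i, a i j • e (i + n * k)`. -/
def blockRep (n : ℕ) [NeZero n] : Matrix (Fin n) (Fin n) ℂ →⋆ₐ[ℂ] (EllTwo →L[ℂ] EllTwo) where
  toFun a := ∑ i, ∑ j, a i j • (shiftOp n i * star (shiftOp n j))
  map_one' := by
    simp only [Matrix.one_apply, ite_smul, one_smul, zero_smul, Finset.sum_ite_eq,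
      Finset.mem_univ, if_true]
    exact sum_shiftOp_mul_star n
  map_zero' := by simp
  map_add' a b := by simp [add_smul, Finset.sum_add_distrib]
  map_mul' a b := by
    have key : ∀ i j k l : Fin n, (shiftOp n i * star (shiftOp n j)) *
        (shiftOp n k * star (shiftOp n l)) =
        if j = k then shiftOp n i * star (shiftOp n l) else 0 := by
      intro i j k l
      rw [mul_assoc, ← mul_assoc (star (shiftOp n j)), star_shiftOp_mul]
      split_ifs <;> simp
    simp only [Finset.sum_mul, Finset.mul_sum, smul_mul_smul_comm, key, smul_ite, smul_zero,
      Matrix.mul_apply, Finset.sum_smul]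
    simp only [Finset.sum_ite_eq', Finset.mem_univ, if_true]
    refine (Finset.sum_congr rfl fun _ _ => Finset.sum_comm).trans ?_
    rw [Finset.sum_comm]
    exact Finset.sum_congr rfl fun _ _ => Finset.sum_comm
  commutes' c := by
    simp only [Algebra.algebraMap_eq_smul_one, Matrix.smul_apply, Matrix.one_apply, smul_eq_mul,
      mul_ite, mul_one, mul_zero, ite_smul, zero_smul, Finset.sum_ite_eq, Finset.mem_univ, if_true,
      ← Finset.smul_sum, sum_shiftOp_mul_star]
  map_star' a := by
    simp only [star_sum, star_smul, star_mul, star_star, Matrix.star_apply]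
    exact Finset.sum_comm

theorem blockRep_basis (n : ℕ) [NeZero n] (a : Matrix (Fin n) (Fin n) ℂ) (j : Fin n) (k : ℕ) :
    blockRep n a (ellBasis (j + n * k)) = ∑ i, a i j • ellBasis (i + n * k) := by
  change (∑ i, ∑ j, a i j • (shiftOp n i * star (shiftOp n j))) (ellBasis (j + n * k)) = _
  rw [sum_apply]
  refine Finset.sum_congr rfl fun i _ => ?_
  rw [sum_apply, Finset.sum_eq_single j]
  · rw [smul_apply, mul_apply_eq_comp, ← shiftOp_basis n j k, ← mul_apply_eq_comp (star _),
      star_shiftOp_mul, if_pos rfl, ← shiftOp_basis n i k]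
    rfl
  · intro l _ hl
    rw [smul_apply, mul_apply_eq_comp, ← shiftOp_basis n j k, ← mul_apply_eq_comp (star _),
      star_shiftOp_mul, if_neg hl, zero_apply, map_zero, smul_zero]
  · intro h
    exact absurd (Finset.mem_univ _) h

/-- The universal UHF algebra `Q`: the closure of the union of the matrix algebras `M_n(ℂ)`,
`n ≥ 1`, in their representations on `ℓ²(ℕ)` by block diagonal operators with constant `n × n`
blocks. If `n` divides `m` then the copy of `M_n(ℂ)` is contained in the copy of `M_m(ℂ)`, so that
`Q` is the inductive limit of the matrix algebras `M_{n!}(ℂ)` under unital embeddings. -/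
def universalUHF : StarSubalgebra ℂ (EllTwo →L[ℂ] EllTwo) :=
  (⨆ n : ℕ, (blockRep (n + 1)).range).topologicalClosure

instance universalUHF_cstarAlgebra : CStarAlgebra universalUHF :=
  StarSubalgebra.cstarAlgebra universalUHF
    (h_closed := StarSubalgebra.isClosed_topologicalClosure _)

end UHF

end

noncomputable section

/-! ### Inverse square roots and polar decompositions close to the identity -/

section Polar

variable {A : Type*} [CStarAlgebra A]

/-! The tensor square is moved inside `D`: with `φ : D ≅ D ⊗ D`, the maps `α d = φ⁻¹(d ⊗ 1)` and `β
d = φ⁻¹(1 ⊗ d)` are unital endomorphisms with commuting ranges, and `α` is a point-norm limit of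
inner automorphisms (`TensorSquare`). Three facts then identify `D`.

Existence: cancellation turns `[1] = n • x` in `K₀` into `[1] = n • [p]` in `V(D)`, which yields a
system of `n × n` matrix units in `D` (`exists_matrix_starAlgHom_of_divisible`).

Uniqueness: for `θ, θ' : M_n → D` the commuting maps `α ∘ θ` and `β ∘ θ'` are exchanged by the flip
unitary of `M_n ⊗ M_n`. Moreover `θ` and `α ∘ θ` are approximately unitarily equivalent, hence
exactly so, because matrix units are stable under small perturbations. Thus all `θ` are equivalent
to one and the same `β ∘ θ'`, and so to each other (`TensorSquare.exists_conj_eq`).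

Local approximation: for suitable `m` the unitary `u_m` carries `φ(β d) = 1 ⊗ d` close to `β d ⊗ 1`.
Represent the first factor quasidiagonally and cut down by `P ⊗ 1`, with `P` a finite rank
projection almost commuting with everything relevant. The cut-down of `u_m` is an almost unitary
element of `M_l ⊗ D` that moves `1 ⊗ d` close to `M_l ⊗ 1`. Mapping `M_l ⊗ D` to `D` by `(β ∘ θ) ⊗
α`, with `θ : M_l → D` from existence, gives a unitary of `D` moving `α d` close to `β (θ (M_l))`
(`exists_unitary_of_compression`). Since `α` is approximately inner, `d` itself is close to a unital
matrix subalgebra (`TensorSquare.exists_hom_near`).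

Given these facts, `nonempty_starAlgEquiv_universalUHF` builds an increasing chain of matrix
algebras, embedded compatibly in `D` and in the universal UHF algebra, with sizes divisible by every
integer eventually and with dense union on both sides. The two norms agree on each stage, so the
identification extends to the closures. -/

theorem exists_inverse_sqrt_near_one {a : A} (ha : IsSelfAdjoint a) {δ : ℝ} (hδ : δ ≤ 1 / 2)
    (h : ‖a - 1‖ ≤ δ) :
    ∃ r : A, IsSelfAdjoint r ∧ r * a * r = 1 ∧ ‖r - 1‖ ≤ δ ∧ ∀ b, Commute a b → Commute r b := by
  have hspec : ∀ t ∈ spectrum ℝ a, |t - 1| ≤ δ := by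
    intro t ht
    have h1 : t - 1 ∈ spectrum ℝ (a - 1) := by
      have := spectrum.sub_singleton_eq a (1 : ℝ)
      rw [map_one] at this
      rw [← this]
      exact Set.sub_mem_sub ht rfl
    rcases subsingleton_or_nontrivial A with hA | hA
    · rw [spectrum.of_subsingleton] at ht
      exact ht.elim
    · exact (spectrum.norm_le_norm_of_mem h1).trans h
  have hpos : ∀ t ∈ spectrum ℝ a, 1 / 2 ≤ t := fun t ht => by
    have := (abs_le.1 (hspec t ht)).1
    linarith
  have hδ0 : 0 ≤ δ := (norm_nonneg _).trans h
  set f : ℝ → ℝ := fun t => (√t)⁻¹ with hf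
  have hfc : ContinuousOn f (spectrum ℝ a) := by
    refine ContinuousOn.inv₀ Real.continuous_sqrt.continuousOn fun t ht => ?_
    have := hpos t ht
    positivity
  refine ⟨cfc f a, cfc_predicate f a, ?_, ?_, fun b hb => hb.cfc_real f⟩
  · have e1 : cfc f a * a = cfc (fun t => f t * t) a := by
      conv_lhs => rw [← cfc_id' ℝ a]
      rw [cfc_id' ℝ a]
      exact (cfc_mul f (fun t => t) a hfc continuousOn_id).symm ▸ by rw [cfc_id' ℝ a]
    rw [e1, ← cfc_mul (fun t => f t * t) f a (hfc.mul continuousOn_id) hfc]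
    rw [← cfc_one ℝ a]
    refine cfc_congr fun t ht => ?_
    have h2 := hpos t ht
    have h3 : 0 < √t := Real.sqrt_pos.2 (by linarith)
    have h4 : √t * √t = t := Real.mul_self_sqrt (by linarith)
    simp only [hf, Pi.one_apply]
    field_simp
    nlinarith
  · rw [← cfc_one ℝ a, ← cfc_sub f 1 a hfc continuousOn_const]
    refine norm_cfc_le hδ0 fun t ht => ?_
    have h2 := hpos t ht
    have h3 : 0 < √t := Real.sqrt_pos.2 (by linarith)
    have h4 : √t * √t = t := Real.mul_self_sqrt (by linarith)
    have h5 : 1 / 2 ≤ √t := by nlinarith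
    have h6 : 1 ≤ √t * (1 + √t) := by nlinarith
    have h7 := hspec t ht
    -- The denominator is at least `1` on the spectrum, so the distance to `1` does not grow.
    have e : f t - 1 = (1 - t) / (√t * (1 + √t)) := by
      simp only [hf]
      field_simp
      nlinarith
    simp only [Pi.one_apply]
    rw [e, Real.norm_eq_abs, abs_div, abs_of_pos (by positivity : 0 < √t * (1 + √t)),
      abs_sub_comm]
    exact (div_le_self (abs_nonneg _) h6).trans h7

/-- Polar decomposition with `r = (c* c)^(-1/2)`: `c r` is an isometry, and the second hypothesis
makes `c c*` invertible, so that the isometry is onto. The commutation clause for `r` lets `c r`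
keep exact intertwining relations of `c`. -/
theorem exists_unitary_mul_near_one {c : A} {δ : ℝ} (hδ : δ ≤ 1 / 2)
    (h : ‖star c * c - 1‖ ≤ δ) (h' : ‖c * star c - 1‖ ≤ δ) :
    ∃ r : A, ‖r - 1‖ ≤ δ ∧ (∀ b, Commute (star c * c) b → Commute r b) ∧
      c * r ∈ unitary A := by
  obtain ⟨r, hr, hrr, hr1, hrc⟩ := exists_inverse_sqrt_near_one (.star_mul_self c) hδ h
  obtain ⟨q, hq, hqq, -, -⟩ := exists_inverse_sqrt_near_one (.mul_star_self c) hδ h'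
  have hqu : IsUnit q := isUnit_iff_exists.2 ⟨q * (c * star c),  by
    have h1 : q * ((c * star c) * q) = 1 := by rw [← mul_assoc, hqq]
    have h2 : q * (c * star c) = (c * star c) * q := left_inv_eq_right_inv hqq h1
    rw [h2, h1], hqq⟩
  have hru : IsUnit r := isUnit_iff_exists.2 ⟨r * (star c * c),  by
    have h1 : r * ((star c * c) * r) = 1 := by rw [← mul_assoc, hrr]
    have h2 : r * (star c * c) = (star c * c) * r := left_inv_eq_right_inv hrr h1
    rw [h2, h1], hrr⟩
  have hcr : star (c * r) * (c * r) = 1 := by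
    rw [star_mul, hr.star_eq, ← hrr]
    simp only [mul_assoc]
  -- `q` is the inverse square root of `c c*`, so `c* q²` is a right inverse of `c`.
  have hright : c * (star c * q * q) = 1 := by
    obtain ⟨Q, rfl⟩ := hqu
    have : (c * star c) * Q = ↑Q⁻¹ := by
      rw [← mul_one (↑Q⁻¹ : A), ← hqq]
      simp [mul_assoc]
    calc c * (star c * ↑Q * ↑Q) = ((c * star c) * Q) * Q := by simp only [mul_assoc]
      _ = 1 := by rw [this]; simp
  obtain ⟨R, rfl⟩ := hru
  have hright' : (c * ↑R) * (↑R⁻¹ * (star c * q * q)) = 1 := by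
    rw [mul_assoc, ← mul_assoc (R : A)]
    simpa using hright
  refine ⟨R, hr1, hrc, Unitary.mem_iff.2 ⟨hcr, ?_⟩⟩
  rw [left_inv_eq_right_inv hcr hright', hright']

end Polar

/-! ### Matrix units -/

/-- A system of matrix units with sum `1` in a star ring. -/
structure IsMatrixUnits {n A : Type*} [Fintype n] [DecidableEq n] [Ring A] [StarRing A]
    (e : n → n → A) : Prop where
  mul_eq : ∀ i j k l, e i j * e k l = if j = k then e i l else 0
  star_eq : ∀ i j, star (e i j) = e j i
  sum_eq : ∑ i, e i i = 1

section MatrixUnits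

variable {n : Type*} [Fintype n] [DecidableEq n]

/-- Matrix units built from a family of partial isometries with a common initial projection. -/
theorem isMatrixUnits_of_isometries {A : Type*} [Ring A] [StarRing A] {v : n → A} {p : A}
    (hv : ∀ i j, star (v i) * v j = if i = j then p else 0) (hs : ∑ i, v i * star (v i) = 1) :
    IsMatrixUnits fun i j => v i * star (v j) where
  mul_eq i j k l := by
    have hp : v i * p = v i := by
      conv_rhs => rw [← one_mul (v i), ← hs, Finset.sum_mul]
      rw [Finset.sum_eq_single i]
      · rw [mul_assoc, hv, if_pos rfl]
      · intro k _ hk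
        rw [mul_assoc, hv, if_neg hk, mul_zero]
      · simp
    calc v i * star (v j) * (v k * star (v l)) = v i * (star (v j) * v k) * star (v l) := by
          simp only [mul_assoc]
      _ = _ := by
        rw [hv]
        split_ifs
        · rw [hp]
        · simp
  star_eq i j := by simp
  sum_eq := hs

section Ring

variable {A B : Type*} [Ring A] [StarRing A] [Algebra ℂ A] [Ring B] [StarRing B] [Algebra ℂ B]

/-- The unital `*`-homomorphism on a matrix algebra given by a system of matrix units. -/
def IsMatrixUnits.hom [StarModule ℂ A] {e : n → n → A} (h : IsMatrixUnits e) :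
    Matrix n n ℂ →⋆ₐ[ℂ] A where
  toFun a := ∑ i, ∑ j, a i j • e i j
  map_one' := by
    simp only [Matrix.one_apply, ite_smul, one_smul, zero_smul, Finset.sum_ite_eq,
      Finset.mem_univ, if_true]
    exact h.sum_eq
  map_zero' := by simp
  map_add' a b := by simp [add_smul, Finset.sum_add_distrib]
  map_mul' a b := by
    simp only [Finset.sum_mul, Finset.mul_sum, smul_mul_smul_comm, h.mul_eq, smul_ite, smul_zero,
      Matrix.mul_apply, Finset.sum_smul]
    simp only [Finset.sum_ite_eq', Finset.mem_univ, if_true]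
    refine (Finset.sum_congr rfl fun _ _ => Finset.sum_comm).trans ?_
    rw [Finset.sum_comm]
    exact Finset.sum_congr rfl fun _ _ => Finset.sum_comm
  commutes' c := by
    simp only [Algebra.algebraMap_eq_smul_one, Matrix.smul_apply, Matrix.one_apply, smul_eq_mul,
      mul_ite, mul_one, mul_zero, ite_smul, zero_smul, Finset.sum_ite_eq, Finset.mem_univ, if_true,
      ← Finset.smul_sum, h.sum_eq]
  map_star' a := by
    simp only [star_sum, star_smul, h.star_eq, Matrix.star_apply]
    exact Finset.sum_comm

theorem IsMatrixUnits.hom_apply [StarModule ℂ A] {e : n → n → A} (h : IsMatrixUnits e)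
    (a : Matrix n n ℂ) :
    h.hom a = ∑ i, ∑ j, a i j • e i j := rfl

theorem IsMatrixUnits.hom_single [StarModule ℂ A] {e : n → n → A} (h : IsMatrixUnits e) (i j : n) :
    h.hom (Matrix.single i j 1) = e i j := by
  rw [h.hom_apply, Finset.sum_eq_single i, Finset.sum_eq_single j]
  · simp
  · intro k _ hk
    simp [hk.symm]
  · simp
  · intro k _ hk
    simp [hk.symm]
  · simp

theorem isMatrixUnits_single : IsMatrixUnits fun i j : n => Matrix.single i j (1 : ℂ) where
  mul_eq i j k l := by
    split_ifs with h
    · subst h; simp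
    · exact Matrix.single_mul_single_of_ne _ _ _ _ h _
  star_eq i j := by simp [Matrix.star_eq_conjTranspose]
  sum_eq := by
    rw [← Matrix.diagonal_one, ← Matrix.sum_single_eq_diagonal]

theorem IsMatrixUnits.map {e : n → n → A} (h : IsMatrixUnits e) (f : A →⋆ₐ[ℂ] B) :
    IsMatrixUnits fun i j => f (e i j) where
  mul_eq i j k l := by
    rw [← map_mul, h.mul_eq]
    split_ifs <;> simp
  star_eq i j := by rw [← map_star, h.star_eq]
  sum_eq := by rw [← map_sum, h.sum_eq, map_one]

theorem isMatrixUnits_map_single (θ : Matrix n n ℂ →⋆ₐ[ℂ] A) :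
    IsMatrixUnits fun i j => θ (Matrix.single i j 1) := isMatrixUnits_single.map θ

theorem matrix_starAlgHom_ext {θ θ' : Matrix n n ℂ →⋆ₐ[ℂ] A}
    (h : ∀ i j, θ (Matrix.single i j 1) = θ' (Matrix.single i j 1)) : θ = θ' := by
  refine StarAlgHom.ext fun a => ?_
  rw [Matrix.matrix_eq_sum_single a]
  simp only [map_sum]
  refine Finset.sum_congr rfl fun i _ => Finset.sum_congr rfl fun j _ => ?_
  rw [← mul_one (a i j), ← smul_eq_mul, ← Matrix.smul_single, map_smul, map_smul, h]

end Ring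

section CStar

variable {A : Type*} [CStarAlgebra A]

theorem IsMatrixUnits.norm_le_one {e : n → n → A} (h : IsMatrixUnits e) (i j : n) :
    ‖e i j‖ ≤ 1 := by
  have h1 : ‖e j j‖ ≤ 1 := by
    have := CStarRing.norm_star_mul_self (x := e j j)
    rw [h.star_eq, h.mul_eq, if_pos rfl] at this
    nlinarith [norm_nonneg (e j j)]
  have := CStarRing.norm_star_mul_self (x := e i j)
  rw [h.star_eq, h.mul_eq, if_pos rfl] at this
  nlinarith [norm_nonneg (e i j)]

end CStar

end MatrixUnits

/-! ### Perturbation of matrix units -/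

section Perturbation

variable {n : Type*} [Fintype n] [DecidableEq n]

theorem norm_mul_sub_mul_le {A : Type*} [NonUnitalNormedRing A] {a a' b b' : A} {s t α β : ℝ}
    (ha : ‖a‖ ≤ s) (hb' : ‖b'‖ ≤ t) (h : ‖a - a'‖ ≤ α) (h' : ‖b - b'‖ ≤ β) :
    ‖a * b - a' * b'‖ ≤ s * β + α * t := by
  have e : a * b - a' * b' = a * (b - b') + (a - a') * b' := by noncomm_ring
  rw [e]
  refine (norm_add_le _ _).trans (add_le_add ((norm_mul_le _ _).trans ?_)
    ((norm_mul_le _ _).trans ?_))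
  · exact mul_le_mul ha h' (norm_nonneg _) ((norm_nonneg _).trans ha)
  · exact mul_le_mul h hb' (norm_nonneg _) ((norm_nonneg _).trans h)

theorem norm_star_sub_star {A : Type*} [CStarAlgebra A] (a b : A) :
    ‖star a - star b‖ = ‖a - b‖ := by
  rw [← star_sub, norm_star]

/-- Close systems of matrix units are conjugate by a unitary close to the identity. -/
theorem IsMatrixUnits.exists_unitary_conj {A : Type*} [CStarAlgebra A] {e f : n → n → A}
    (he : IsMatrixUnits e) (hf : IsMatrixUnits f) (o : n) {δ : ℝ}
    (hδ : 6 * (Fintype.card n * δ) ≤ 1) (h : ∀ i, ‖f o i - e o i‖ ≤ δ) :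
    ∃ u : unitary A, ‖(u : A) - 1‖ ≤ 5 * (Fintype.card n * δ) ∧
      ∀ i j, e i j = u * f i j * star (u : A) := by
  set η := Fintype.card n * δ with hη
  -- `s` intertwines `f` and `e` exactly, and it equals `1` when `f = e`; only the row `o` of the
  -- two systems enters.
  set s : A := ∑ i, e i o * f o i with hs
  have hs1 : ‖s - 1‖ ≤ η := by
    have e1 : s - 1 = ∑ i, e i o * (f o i - e o i) := by
      rw [hs, ← he.sum_eq, ← Finset.sum_sub_distrib]
      refine Finset.sum_congr rfl fun i _ => ?_
      rw [mul_sub, he.mul_eq, if_pos rfl]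
    rw [e1, hη]
    refine (norm_sum_le _ _).trans ?_
    refine (Finset.sum_le_card_nsmul _ _ δ fun i _ => ?_).trans_eq (by
      rw [nsmul_eq_mul, Finset.card_univ])
    refine (norm_mul_le _ _).trans ?_
    have := he.norm_le_one i o
    have := h i
    nlinarith [norm_nonneg (e i o), norm_nonneg (f o i - e o i)]
  have hη0 : 0 ≤ η := (norm_nonneg _).trans hs1
  have hint : ∀ k l, s * f k l = e k l * s := by
    intro k l
    rw [hs, Finset.sum_mul, Finset.mul_sum, Finset.sum_eq_single k, Finset.sum_eq_single l]
    · rw [mul_assoc, hf.mul_eq, if_pos rfl, ← mul_assoc, he.mul_eq, if_pos rfl]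
    · intro j _ hj
      rw [← mul_assoc, he.mul_eq, if_neg hj.symm, zero_mul]
    · simp
    · intro j _ hj
      rw [mul_assoc, hf.mul_eq, if_neg hj, mul_zero]
    · simp
  have hint' : ∀ k l, f k l * star s = star s * e k l := by
    intro k l
    have := congrArg star (hint l k)
    rwa [star_mul, star_mul, hf.star_eq, he.star_eq] at this
  have h1 : ‖(1 : A)‖ ≤ 1 := by
    have := CStarRing.norm_star_mul_self (x := (1 : A))
    rw [star_one, mul_one] at this
    nlinarith [norm_nonneg (1 : A)]
  have hsn : ‖s‖ ≤ 1 + η := by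
    have := norm_add_le (s - 1) 1
    rw [sub_add_cancel] at this
    linarith
  have hsn' : ‖star s - 1‖ ≤ η := by
    rw [← star_one A, norm_star_sub_star]; exact hs1
  have hq : ‖star s * s - 1‖ ≤ 3 * η := by
    have := norm_mul_sub_mul_le (by rwa [norm_star] : ‖star s‖ ≤ 1 + η) h1 hsn' hs1
    rw [mul_one] at this
    nlinarith
  have hq' : ‖s * star s - 1‖ ≤ 3 * η := by
    have := norm_mul_sub_mul_le hsn h1 hs1 hsn'
    rw [mul_one] at this
    nlinarith
  obtain ⟨r, hr1, hrc, hu⟩ := exists_unitary_mul_near_one (by linarith) hq hq'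
  refine ⟨⟨s * r, hu⟩, ?_, fun i j => ?_⟩
  · have := norm_mul_sub_mul_le hsn h1 hs1 hr1
    rw [mul_one] at this
    simp only
    nlinarith
  -- `s* s` commutes with every `f i j`, hence so does `r`: passing to the unitary part does not
  -- spoil the intertwining.
  · have hc : r * f i j = f i j * r := hrc _ (by
      rw [Commute, SemiconjBy, mul_assoc, hint, ← mul_assoc, ← hint', mul_assoc])
    have h2 : s * r * f i j = e i j * (s * r) := by
      rw [mul_assoc, hc, ← mul_assoc, hint, mul_assoc]
    rw [h2, mul_assoc, (Unitary.mem_iff.1 hu).2, mul_one]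

/-- The element `s = 2b - 1` satisfies `s² - 1 = 4(b² - b)`, so it is almost a symmetry; its sign `t
= s (s²)^(-1/2)` is a symmetry, and `(1 + t)/2` is the projection. The bound on `δ` keeps `s²`
within `1/2` of `1`. -/
theorem exists_projection_near {A : Type*} [CStarAlgebra A] {b : A} (hb : IsSelfAdjoint b)
    {δ : ℝ} (hδ : 8 * δ ≤ 1) (h : ‖b * b - b‖ ≤ δ) :
    ∃ p : A, IsStarProjection p ∧ ‖p - b‖ ≤ 4 * δ := by
  have h1 : ‖(1 : A)‖ ≤ 1 := by
    have := CStarRing.norm_star_mul_self (x := (1 : A))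
    rw [star_one, mul_one] at this
    nlinarith [norm_nonneg (1 : A)]
  set s : A := (2 : ℝ) • b - 1 with hs
  have hsa : IsSelfAdjoint s := ((IsSelfAdjoint.all (2 : ℝ)).smul hb).sub (.one A)
  have hss : s * s - 1 = (4 : ℝ) • (b * b - b) := by
    rw [hs]
    simp only [sub_mul, mul_sub, smul_mul_assoc, mul_smul_comm, smul_smul, one_mul, mul_one,
      smul_sub]
    module
  have hn : ‖s * s - 1‖ ≤ 4 * δ := by
    rw [hss, norm_smul]
    norm_num
    exact h
  have hδ0 : 0 ≤ δ := (norm_nonneg _).trans h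
  have hsn : ‖s‖ ≤ 2 := by
    have h2 := CStarRing.norm_star_mul_self (x := s)
    rw [hsa.star_eq] at h2
    have h3 := norm_add_le (s * s - 1) 1
    rw [sub_add_cancel] at h3
    nlinarith [norm_nonneg s]
  have hss' : IsSelfAdjoint (s * s) := by
    have := IsSelfAdjoint.star_mul_self s
    rwa [hsa.star_eq] at this
  obtain ⟨r, hr, hrr, hr1, hrc⟩ := exists_inverse_sqrt_near_one hss' (by linarith) hn
  have hcomm : r * s = s * r := hrc s (by rw [Commute, SemiconjBy, mul_assoc])
  set t : A := s * r with ht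
  have htsa : star t = t := by rw [ht, star_mul, hr.star_eq, hsa.star_eq, hcomm]
  have htt : t * t = 1 := by
    rw [← hrr, ht]
    calc s * r * (s * r) = (r * s) * (s * r) := by rw [hcomm]
      _ = _ := by simp only [mul_assoc]
  refine ⟨(1 / 2 : ℝ) • (1 + t), ⟨?_, ?_⟩, ?_⟩
  · rw [IsIdempotentElem]
    simp only [smul_mul_smul_comm, add_mul, mul_add, htt, one_mul, mul_one]
    module
  · exact (IsSelfAdjoint.all (1 / 2 : ℝ)).smul ((IsSelfAdjoint.one A).add htsa)
  · have e : (1 / 2 : ℝ) • (1 + t) - b = (1 / 2 : ℝ) • (s * (r - 1)) := by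
      rw [mul_sub, mul_one, ← ht, hs]
      module
    rw [e, norm_smul]
    have := norm_mul_le s (r - 1)
    norm_num
    nlinarith [norm_nonneg s, norm_nonneg (r - 1)]

/-- A system of matrix units whose column is close to a C*-subalgebra is close to a system of
matrix units of the subalgebra. -/
theorem IsMatrixUnits.exists_near_of_column {A B : Type*} [CStarAlgebra A] [CStarAlgebra B]
    (j : B →⋆ₐ[ℂ] A) (hj : Function.Injective j) {e : n → n → A} (he : IsMatrixUnits e) (o : n)
    {δ : ℝ} (hδ : 600 * (Fintype.card n * (Fintype.card n * δ)) ≤ 1) (x : n → B)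
    (hx : ∀ i, ‖j (x i) - e i o‖ ≤ δ) :
    ∃ f : n → n → B, IsMatrixUnits f ∧ ∀ k l, ‖j (f k l) - e k l‖ ≤ 400 * (Fintype.card n * δ) := by
  have hnorm : ∀ b, ‖b‖ = ‖j b‖ := fun b => (NonUnitalStarAlgHom.norm_map j hj b).symm
  have hN : (1 : ℝ) ≤ Fintype.card n := by
    exact_mod_cast Fintype.card_pos_iff.2 ⟨o⟩
  set N : ℝ := (Fintype.card n : ℝ) with hNdef
  have hδ0 : 0 ≤ δ := (norm_nonneg _).trans (hx o)
  have hNδ : δ ≤ N * δ := by nlinarith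
  have hNNδ : N * δ ≤ N * (N * δ) := by nlinarith [mul_nonneg (zero_le_one.trans hN) hδ0]
  have he1 := he.norm_le_one
  have hnear : ∀ (a : B) (i k : n) (η : ℝ), ‖j a - e i k‖ ≤ η → ‖a‖ ≤ 1 + η := fun a i k η h => by
    rw [hnorm]
    have := norm_add_le (j a - e i k) (e i k)
    rw [sub_add_cancel] at this
    linarith [he1 i k]
  -- a projection `p` of `B` near `e o o`
  obtain ⟨p, hp, hpe⟩ : ∃ p : B, IsStarProjection p ∧ ‖j p - e o o‖ ≤ 17 * δ := by
    -- The real part of `x o` is self-adjoint and no farther from the projection `e o o`.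
    set b : B := (1 / 2 : ℝ) • (x o + star (x o)) with hb
    have hbs : IsSelfAdjoint b := (IsSelfAdjoint.all (1 / 2 : ℝ)).smul (.add_star_self _)
    have hbe : ‖j b - e o o‖ ≤ δ := by
      have e1 : j b - e o o =
          (1 / 2 : ℝ) • ((j (x o) - e o o) + (star (j (x o)) - star (e o o))) := by
        have h2 : j b = (1 / 2 : ℝ) • (j (x o) + star (j (x o))) := by
          rw [hb, ← map_star, ← map_add]
          have := map_smul j (1 / 2 : ℂ) (x o + star (x o))
          have e2 : ((1 / 2 : ℝ) : ℂ) = 1 / 2 := by norm_num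
          rw [← Complex.coe_smul (1 / 2), ← Complex.coe_smul (1 / 2), e2, this]
        rw [h2, he.star_eq]
        module
      rw [e1, norm_smul]
      have h3 := norm_add_le (j (x o) - e o o) (star (j (x o)) - star (e o o))
      rw [norm_star_sub_star] at h3
      norm_num
      linarith [hx o]
    have hbb : ‖b * b - b‖ ≤ 4 * δ := by
      rw [hnorm, map_sub, map_mul]
      have h1 := norm_mul_sub_mul_le (hnorm b ▸ hnear b o o δ hbe) (he1 o o) hbe hbe
      rw [he.mul_eq, if_pos rfl] at h1
      have e1 : j b * j b - j b = (j b * j b - e o o) - (j b - e o o) := by abel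
      rw [e1]
      refine (norm_sub_le _ _).trans ?_
      nlinarith
    obtain ⟨p, hp, hpb⟩ := exists_projection_near hbs (by linarith) hbb
    refine ⟨p, hp, ?_⟩
    have e1 : j p - e o o = j (p - b) + (j b - e o o) := by rw [map_sub]; abel
    rw [e1]
    refine (norm_add_le _ _).trans ?_
    rw [← hnorm]
    linarith
  have hpp : p * p = p := hp.isIdempotentElem
  have hps : star p = p := hp.isSelfAdjoint
  have hpn := hnear p o o _ hpe
  -- Cutting by `p` on the right gives the column elements initial support under `p`.
  set y : n → B := fun i => x i * p with hy
  have hye : ∀ i, ‖j (y i) - e i o‖ ≤ 19 * δ := fun i => by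
    have h1 := norm_mul_sub_mul_le (hnorm (x i) ▸ hnear _ i o δ (hx i)) (he1 o o) (hx i) hpe
    rw [he.mul_eq, if_pos rfl, ← map_mul] at h1
    refine h1.trans ?_
    nlinarith
  have hyn : ∀ i, ‖y i‖ ≤ 2 := fun i => (hnear _ i o _ (hye i)).trans (by linarith)
  set c : B := ∑ i, y i * star (y i) with hc
  have hcs : IsSelfAdjoint c := isSelfAdjoint_sum _ fun i _ => .mul_star_self _
  have hc1 : ‖c - 1‖ ≤ 57 * (N * δ) := by
    have e1 : j (c - 1) = ∑ i, (j (y i) * star (j (y i)) - e i o * star (e i o)) := by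
      rw [Finset.sum_sub_distrib]
      simp only [he.star_eq, he.mul_eq, if_true, he.sum_eq, hc, map_sub, map_sum, map_mul,
        map_star, map_one]
    rw [hnorm, e1]
    refine (norm_sum_le _ _).trans ((Finset.sum_le_card_nsmul _ _ (57 * δ) fun i _ => ?_).trans_eq
      (by rw [nsmul_eq_mul, Finset.card_univ]; ring))
    have h1 := norm_mul_sub_mul_le (s := 2) (t := 1) (b' := star (e i o)) (hnorm (y i) ▸ hyn i)
      (by rw [norm_star]; exact he1 i o) (hye i)
      ((norm_star_sub_star _ _).trans_le (hye i))
    refine h1.trans ?_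
    linarith
  obtain ⟨r, hr, hrr, hr1, -⟩ := exists_inverse_sqrt_near_one hcs (by linarith) hc1
  -- Normalizing by `(∑ y y*)^(-1/2)` on the left makes `∑ v v* = 1` exact; the relations `v i* v k
  -- = δ p` remain to be proved.
  set v : n → B := fun i => r * y i with hv
  set η := 133 * (N * δ) with hη
  have hve : ∀ i, ‖j (v i) - e i o‖ ≤ η := fun i => by
    have e1 : j (v i) - e i o = j ((r - 1) * y i) + (j (y i) - e i o) := by
      rw [hv]; simp only [sub_mul, one_mul, map_sub]; abel
    rw [e1]
    refine (norm_add_le _ _).trans ?_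
    rw [← hnorm]
    have := norm_mul_le (r - 1) (y i)
    have := hye i
    have := hyn i
    nlinarith [norm_nonneg (r - 1), norm_nonneg (y i)]
  have hη1 : η ≤ 1 := by linarith
  have hvn : ∀ i, ‖v i‖ ≤ 2 := fun i => (hnear _ i o _ (hve i)).trans (by linarith)
  have hvv : ∑ i, v i * star (v i) = 1 := by
    rw [← hrr, hc, Finset.mul_sum, Finset.sum_mul]
    refine Finset.sum_congr rfl fun i _ => ?_
    simp only [hv, star_mul, hr.star_eq, mul_assoc]
  have hvp : ∀ i, v i * p = v i := fun i => by simp only [hv, hy, mul_assoc, hpp]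
  have hpv : ∀ i, p * star (v i) = star (v i) := fun i => by
    rw [← hvp i, star_mul, hps, ← mul_assoc, hpp]
  set d : n → n → B := fun i k => if i = k then p else 0 with hd
  set h : n → n → B := fun i k => d i k - star (v i) * v k with hh
  -- As a matrix over `B`, `h` is the difference of the projection `diag(p)` and its subprojection
  -- `(v i* v k)`, hence idempotent. An idempotent of small norm vanishes.
  have hhh : ∀ i k, h i k = ∑ l, h i l * h l k := by
    intro i k
    have e1 : ∀ l, h i l * h l k =
        d i l * d l k - d i l * (star (v l) * v k) - (star (v i) * v l) * d l k +
        star (v i) * (v l * star (v l)) * v k := fun l => by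
      simp only [hh]; noncomm_ring
    simp only [e1, Finset.sum_add_distrib, Finset.sum_sub_distrib, ← Finset.mul_sum,
      ← Finset.sum_mul, hvv, mul_one]
    simp only [hd, hh, mul_ite, ite_mul, zero_mul, mul_zero, Finset.sum_ite_eq,
      Finset.sum_ite_eq', Finset.mem_univ, if_true, hpp, mul_assoc, hvp, ← mul_assoc p, hpv]
    split_ifs <;> abel
  have hhn : ∀ i k, ‖h i k‖ ≤ 4 * η := fun i k => by
    have h1 := norm_mul_sub_mul_le (s := 2) (t := 1) (a := star (j (v i))) (a' := star (e i o))
      (by rw [norm_star, ← hnorm]; exact hvn i)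
      (he1 k o) ((norm_star_sub_star _ _).trans_le (hve i)) (hve k)
    rw [he.star_eq, he.mul_eq] at h1
    have h2 : ‖j (d i k) - (if i = k then e o o else 0)‖ ≤ η := by
      simp only [hd]
      split_ifs with hik
      · exact hpe.trans (by linarith)
      · simp only [map_zero, sub_zero, norm_zero]; linarith
    have e1 : j (h i k) = (j (d i k) - (if i = k then e o o else 0)) -
        (star (j (v i)) * j (v k) - (if i = k then e o o else 0)) := by
      simp only [hh, map_sub, map_mul, map_star]; abel
    rw [hnorm, e1]
    refine (norm_sub_le _ _).trans ?_
    linarith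
  -- For the largest entry norm `M`, idempotency gives `M ≤ N M²`, while `N M ≤ 532/600 < 1`. This
  -- estimate is the reason for the square of `Fintype.card n` in `hδ`.
  have hh0 : ∀ i k, h i k = 0 := by
    obtain ⟨m, -, hm⟩ := Finset.exists_max_image (Finset.univ : Finset (n × n))
      (fun q => ‖h q.1 q.2‖) ⟨(o, o), Finset.mem_univ _⟩
    have hm' : ∀ i k, ‖h i k‖ ≤ ‖h m.1 m.2‖ := fun i k => hm (i, k) (Finset.mem_univ _)
    have h1 : ‖h m.1 m.2‖ ≤ N * (‖h m.1 m.2‖ * ‖h m.1 m.2‖) := by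
      conv_lhs => rw [hhh]
      refine (norm_sum_le _ _).trans ((Finset.sum_le_card_nsmul _ _ _ fun i _ =>
        (norm_mul_le _ _).trans (mul_le_mul (hm' _ _) (hm' _ _) (norm_nonneg _)
          (norm_nonneg _))).trans_eq (by rw [nsmul_eq_mul, Finset.card_univ]))
    have h2 := hhn m.1 m.2
    have h3 : N * ‖h m.1 m.2‖ ≤ 532 / 600 := by
      have := mul_le_mul_of_nonneg_left h2 (zero_le_one.trans hN)
      refine this.trans ?_
      rw [hη]
      linarith
    have h4 : ‖h m.1 m.2‖ ≤ 0 := by nlinarith [norm_nonneg (h m.1 m.2)]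
    intro i k
    exact norm_le_zero_iff.1 ((hm' i k).trans h4)
  refine ⟨_, isMatrixUnits_of_isometries (v := v) (p := p)
    (fun i k => (sub_eq_zero.1 (hh0 i k)).symm) hvv, fun k l => ?_⟩
  have h1 := norm_mul_sub_mul_le (s := 2) (t := 1) (b := star (j (v l))) (b' := star (e l o))
    (hnorm (v k) ▸ hvn k) (by rw [norm_star]; exact he1 l o) (hve k)
    ((norm_star_sub_star _ _).trans_le (hve l))
  rw [he.star_eq, he.mul_eq, if_pos rfl] at h1
  rw [map_mul, map_star]
  refine h1.trans ?_
  linarith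

/-! ### Unitary equivalence of representations of matrix algebras -/

/-- Conjugation by a unitary, as a `*`-homomorphism. -/
def StarAlgHom.conj {A B : Type*} [Semiring A] [Star A] [Algebra ℂ A] [Ring B] [StarRing B]
    [Algebra ℂ B] (u : unitary B) (θ : A →⋆ₐ[ℂ] B) : A →⋆ₐ[ℂ] B :=
  ((Unitary.conjStarAlgAut ℂ B u : B ≃⋆ₐ[ℂ] B) : B →⋆ₐ[ℂ] B).comp θ

theorem StarAlgHom.conj_apply {A B : Type*} [Semiring A] [Star A] [Algebra ℂ A] [Ring B]
    [StarRing B] [Algebra ℂ B] (u : unitary B) (θ : A →⋆ₐ[ℂ] B) (a : A) :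
    StarAlgHom.conj u θ a = u * θ a * star (u : B) := rfl

end Perturbation

/-! ### Unital embeddings of matrix algebras -/

section MatrixEmbedding

open scoped Kronecker

/-- The embedding `a ↦ 1 ⊗ a` of `M_n(ℂ)` into `M_{rn}(ℂ)` as block diagonal matrices with
constant blocks. -/
def blockEmbedding (r n : ℕ) :
    Matrix (Fin n) (Fin n) ℂ →⋆ₐ[ℂ] Matrix (Fin (r * n)) (Fin (r * n)) ℂ where
  toFun a := ((1 : Matrix (Fin r) (Fin r) ℂ) ⊗ₖ a).submatrix
    finProdFinEquiv.symm finProdFinEquiv.symm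
  map_one' := by
    rw [Matrix.one_kronecker_one, Matrix.submatrix_one_equiv]
  map_zero' := by rw [Matrix.kronecker_zero, Matrix.submatrix_zero]; rfl
  map_add' a b := by simp only [Matrix.kronecker_add, Matrix.submatrix_add]; rfl
  map_mul' a b := by
    rw [Matrix.submatrix_mul_equiv, ← Matrix.mul_kronecker_mul, one_mul]
  commutes' c := by
    simp only [Algebra.algebraMap_eq_smul_one]
    rw [Matrix.kronecker_smul, Matrix.one_kronecker_one, Matrix.submatrix_smul]
    simp
  map_star' a := by
    rw [Matrix.star_eq_conjTranspose, Matrix.star_eq_conjTranspose,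
      Matrix.conjTranspose_submatrix, Matrix.conjTranspose_kronecker, Matrix.conjTranspose_one]

theorem blockEmbedding_apply (r n : ℕ) (a : Matrix (Fin n) (Fin n) ℂ) (p q : Fin r × Fin n) :
    blockEmbedding r n a (finProdFinEquiv p) (finProdFinEquiv q) =
      if p.1 = q.1 then a p.2 q.2 else 0 := by
  change ((1 : Matrix (Fin r) (Fin r) ℂ) ⊗ₖ a) _ _ = _
  rw [Equiv.symm_apply_apply, Equiv.symm_apply_apply, Matrix.kronecker_apply, Matrix.one_apply]
  split_ifs <;> simp

/-- A block of length `r n` consists of `r` consecutive blocks of length `n`: in digits, `i + n s +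
r n K = i + n (s + r K)`. Hence the copies of matrix algebras in the universal UHF algebra are
nested according to divisibility. -/
theorem blockRep_blockEmbedding (r n : ℕ) [NeZero n] [NeZero (r * n)]
    (a : Matrix (Fin n) (Fin n) ℂ) : blockRep (r * n) (blockEmbedding r n a) = blockRep n a := by
  refine ellTwo_op_ext fun k => ?_
  have hn : 0 < n := Nat.pos_of_ne_zero (NeZero.ne n)
  have hr : 0 < r := Nat.pos_of_ne_zero fun h => NeZero.ne (r * n) (by rw [h, zero_mul])
  obtain ⟨q, K, hk⟩ : ∃ (q : Fin r × Fin n) (K : ℕ), k = finProdFinEquiv q + r * n * K := by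
    refine ⟨(⟨k / n % r, Nat.mod_lt _ hr⟩, ⟨k % n, Nat.mod_lt _ hn⟩), k / n / r, ?_⟩
    have h1 := Nat.mod_add_div k n
    have h2 := Nat.mod_add_div (k / n) r
    simp only [finProdFinEquiv_apply_val]
    calc k = k % n + n * (k / n) := h1.symm
      _ = k % n + n * (k / n % r + r * (k / n / r)) := by rw [h2]
      _ = _ := by ring
  have hk' : k = q.2 + n * (q.1 + r * K) := by
    rw [hk, finProdFinEquiv_apply_val]; ring
  rw [hk, blockRep_basis, ← hk, hk', blockRep_basis, ← finProdFinEquiv.sum_comp,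
    Fintype.sum_prod_type, Finset.sum_eq_single q.1]
  · refine Finset.sum_congr rfl fun i _ => ?_
    rw [blockEmbedding_apply, if_pos rfl, finProdFinEquiv_apply_val]
    congr 2
    ring
  · intro s _ hs
    refine Finset.sum_eq_zero fun i _ => ?_
    rw [blockEmbedding_apply, if_neg hs, zero_smul]
  · simp

/-- Every unital `*`-homomorphism between matrix algebras is unitarily equivalent to a
block embedding. -/
theorem exists_conj_blockEmbedding {n l : ℕ} [NeZero n]
    (θ : Matrix (Fin n) (Fin n) ℂ →⋆ₐ[ℂ] Matrix (Fin l) (Fin l) ℂ) :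
    ∃ (r : ℕ) (h : l = r * n) (U : unitary (Matrix (Fin l) (Fin l) ℂ)),
      θ = StarAlgHom.conj U (h ▸ blockEmbedding r n) := by
  set E := EuclideanSpace ℂ (Fin l)
  set g : Fin n → Fin n → E →L[ℂ] E :=
    fun i j => Matrix.toEuclideanCLM (n := Fin l) (𝕜 := ℂ) (θ (Matrix.single i j 1)) with hg
  have hgm : ∀ i j k m x, g i j (g k m x) = if j = k then g i m x else 0 := by
    intro i j k m x
    have h1 := (isMatrixUnits_map_single θ).mul_eq i j k m
    have h2 : g i j * g k m = if j = k then g i m else 0 := by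
      simp only [hg]
      rw [← map_mul, h1]
      split_ifs <;> simp
    change (g i j * g k m) x = _
    rw [h2]
    split_ifs <;> rfl
  have hgs : ∀ i j, ContinuousLinearMap.adjoint (g i j) = g j i := by
    intro i j
    rw [← ContinuousLinearMap.star_eq_adjoint]
    simp only [hg]
    rw [← map_star, (isMatrixUnits_map_single θ).star_eq]
  have hg1 : ∀ x, ∑ i, g i i x = x := by
    intro x
    have h1 : ∑ i, g i i = 1 := by
      simp only [hg]
      rw [← map_sum, (isMatrixUnits_map_single θ).sum_eq, map_one]
    rw [← sum_apply, h1]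
    rfl
  -- The dimension `r` of the range of one minimal projection is the multiplicity of the
  -- representation.
  set W : Submodule ℂ E := LinearMap.range (g 0 0).toLinearMap with hW
  set b := stdOrthonormalBasis ℂ W with hb
  set r := Module.finrank ℂ W with hr
  have hbW : ∀ s, g 0 0 (b s : E) = b s := fun s => by
    obtain ⟨y, hy⟩ := (b s).2
    rw [← hy]
    exact (hgm 0 0 0 0 y).trans (if_pos rfl)
  -- Transporting an orthonormal basis of `W` by the first column of matrix units gives an
  -- orthonormal basis of the whole space in which the representation is block diagonal.
  set x : Fin r × Fin n → E := fun q => g q.2 0 (b q.1 : E) with hx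
  have hon : Orthonormal ℂ x := by
    rw [orthonormal_iff_ite]
    intro p q
    simp only [hx]
    rw [← hgs 0 p.2, ContinuousLinearMap.adjoint_inner_left, hgm]
    by_cases h2 : p.2 = q.2
    · rw [if_pos h2, hbW, ← Submodule.coe_inner, orthonormal_iff_ite.1 b.orthonormal]
      simp [Prod.ext_iff, h2]
    · rw [if_neg h2, inner_zero_right, if_neg fun h => h2 (congrArg Prod.snd h)]
  have hspan : ⊤ ≤ Submodule.span ℂ (Set.range x) := by
    intro y _
    rw [← hg1 y]
    refine Submodule.sum_mem _ fun i _ => ?_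
    have h1 : g i i y = g i 0 (g 0 i y) := ((hgm i 0 0 i y).trans (if_pos rfl)).symm
    have h2 : g 0 i y ∈ W := ⟨g 0 i y, (hgm 0 0 0 i y).trans (if_pos rfl)⟩
    have h3 : (∑ s, inner ℂ (b s) (⟨_, h2⟩ : W) • (b s : E)) = g 0 i y := by
      have := congrArg (Subtype.val) (b.sum_repr' ⟨_, h2⟩)
      simpa using this
    rw [h1, ← h3, map_sum]
    refine Submodule.sum_mem _ fun s _ => ?_
    rw [map_smul]
    exact Submodule.smul_mem _ _ (Submodule.subset_span ⟨(s, i), rfl⟩)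
  set B := OrthonormalBasis.mk hon hspan with hB
  have hl : l = r * n := by
    have h1 := Module.finrank_eq_card_basis B.toBasis
    have h2 : Module.finrank ℂ E = l := by simp [E]
    rw [h2] at h1
    simpa using h1
  clear_value r
  subst hl
  set B' := B.reindex finProdFinEquiv with hB'
  have hBx : ∀ q, B' (finProdFinEquiv q) = x q := fun q => by
    rw [hB', OrthonormalBasis.reindex_apply, Equiv.symm_apply_apply, hB,
      OrthonormalBasis.coe_mk]
  set U : Matrix (Fin (r * n)) (Fin (r * n)) ℂ :=
    (EuclideanSpace.basisFun (Fin (r * n)) ℂ).toBasis.toMatrix B' with hU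
  have hUu : U ∈ unitary (Matrix (Fin (r * n)) (Fin (r * n)) ℂ) :=
    OrthonormalBasis.toMatrix_orthonormalBasis_mem_unitary _ _
  have hUe : ∀ k m, U k m = B' m k := fun k m => by
    simp [hU, Module.Basis.toMatrix_apply]
  refine ⟨r, rfl, ⟨U, hUu⟩, matrix_starAlgHom_ext fun i j => ?_⟩
  rw [StarAlgHom.conj_apply]
  have key : θ (Matrix.single i j 1) * U = U * blockEmbedding r n (Matrix.single i j 1) := by
    ext k m
    obtain ⟨q, rfl⟩ := finProdFinEquiv.surjective m
    have h1 : (θ (Matrix.single i j 1) * U) k (finProdFinEquiv q) = g i j (x q) k := by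
      rw [Matrix.mul_apply, ← hBx]
      simp only [hUe]
      rfl
    have h2 : g i j (x q) = if j = q.2 then x (q.1, i) else 0 := hgm i j q.2 0 _
    rw [h1, h2, Matrix.mul_apply, ← finProdFinEquiv.sum_comp]
    simp only [blockEmbedding_apply, hUe, hBx]
    rw [Finset.sum_eq_single (q.1, i)]
    · by_cases h : j = q.2 <;> simp [h]
    · rintro ⟨s, t⟩ _ hst
      by_cases h : s = q.1
      · have : i ≠ t := fun h' => hst (by rw [h, h'])
        simp [this]
      · simp [h]
    · simp
  rw [← key, mul_assoc, (Unitary.mem_iff.1 hUu).2, mul_one]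

theorem matrix_starAlgHom_injective {n A : Type*} [Fintype n] [DecidableEq n] [Ring A]
    [StarRing A] [Algebra ℂ A] [Nontrivial A] (θ : Matrix n n ℂ →⋆ₐ[ℂ] A) :
    Function.Injective θ := by
  rcases isEmpty_or_nonempty n with h | h
  · exact Function.injective_of_subsingleton _
  · exact (θ : Matrix n n ℂ →+* A).injective

open scoped Matrix.Norms.L2Operator in
-- Matrix algebras are simple, so both homomorphisms are injective and therefore isometric for the
-- operator norm. This makes the graphs of the chain isometric.
theorem norm_matrix_starAlgHom_eq {n A B : Type*} [Fintype n] [DecidableEq n] [CStarAlgebra A]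
    [Nontrivial A] [CStarAlgebra B] [Nontrivial B] (θ : Matrix n n ℂ →⋆ₐ[ℂ] A)
    (θ' : Matrix n n ℂ →⋆ₐ[ℂ] B) (a : Matrix n n ℂ) : ‖θ a‖ = ‖θ' a‖ := by
  rw [NonUnitalStarAlgHom.norm_map θ (matrix_starAlgHom_injective θ),
    NonUnitalStarAlgHom.norm_map θ' (matrix_starAlgHom_injective θ')]

end MatrixEmbedding

/-! ### Isomorphisms from isometric graphs -/

section Graph

theorem bijective_of_isometric_of_dense {A B : Type*} [NormedRing A] [Algebra ℂ A] [Star A]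
    [CompleteSpace A] [NormedRing B] [Algebra ℂ B] [Star B] (f : A →⋆ₐ[ℂ] B)
    (hf : ∀ x, ‖f x‖ = ‖x‖) (hd : DenseRange f) : Function.Bijective f := by
  have hiso : Isometry f := AddMonoidHomClass.isometry_of_norm f hf
  refine ⟨hiso.injective, Set.range_eq_univ.1 ?_⟩
  rw [← hiso.isClosedEmbedding.isClosed_range.closure_eq]
  exact hd.closure_range

/-- A `*`-subalgebra of `A × B` on which the two coordinates have the same norm, and whose
projections to `A` and `B` are dense, is the graph of an isomorphism defined on a dense
subalgebra. -/
theorem nonempty_starAlgEquiv_of_isometric_graph {A B : Type*} [CStarAlgebra A] [CStarAlgebra B]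
    (G : StarSubalgebra ℂ (A × B)) (hG : ∀ x ∈ G, ‖x.1‖ = ‖x.2‖)
    (hA : Dense (Prod.fst '' (G : Set (A × B)))) (hB : Dense (Prod.snd '' (G : Set (A × B)))) :
    Nonempty (A ≃⋆ₐ[ℂ] B) := by
  set G' := G.topologicalClosure with hG'
  have hcl : IsClosed (G' : Set (A × B)) := G.isClosed_topologicalClosure
  have hnorm : ∀ x ∈ G', ‖x.1‖ = ‖x.2‖ := by
    have : (G' : Set (A × B)) ⊆ {x | ‖x.1‖ = ‖x.2‖} := by
      rw [hG', StarSubalgebra.topologicalClosure_coe]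
      exact closure_minimal hG (isClosed_eq (by fun_prop) (by fun_prop))
    exact this
  have : CompleteSpace G' := hcl.completeSpace_coe
  have h1 : ∀ x : G', ‖(x : A × B).1‖ = ‖x‖ := fun x => by
    change _ = ‖(x : A × B)‖
    rw [Prod.norm_def, ← hnorm x x.2, max_self]
  have h2 : ∀ x : G', ‖(x : A × B).2‖ = ‖x‖ := fun x => by rw [← h1, hnorm x x.2]
  have hGG : (G : Set (A × B)) ⊆ G' := G.le_topologicalClosure
  -- Equality of the coordinate norms makes both coordinate maps on the closed graph isometric; with
  -- dense range they are isomorphisms, and the graph is that of the desired map.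
  have b1 := bijective_of_isometric_of_dense ((StarAlgHom.fst ℂ A B).comp G'.subtype) h1
    (hA.mono (by rintro _ ⟨x, hx, rfl⟩; exact ⟨⟨x, hGG hx⟩, rfl⟩))
  have b2 := bijective_of_isometric_of_dense ((StarAlgHom.snd ℂ A B).comp G'.subtype) h2
    (hB.mono (by rintro _ ⟨x, hx, rfl⟩; exact ⟨⟨x, hGG hx⟩, rfl⟩))
  exact ⟨(StarAlgEquiv.ofBijective _ b1).symm.trans (StarAlgEquiv.ofBijective _ b2)⟩

end Graph

/-! ### Recognizing the universal UHF algebra -/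

section UHFRecognition

variable {D : Type*} [CStarAlgebra D]

theorem norm_conj_sub_le (u : unitary D) (x y : D) {ε η : ℝ} (hx : ‖x - y‖ ≤ ε)
    (hu : ‖(u : D) - 1‖ ≤ η) : ‖(u : D) * x * star (u : D) - y‖ ≤ ε + 2 * η * ‖y‖ := by
  have hη : 0 ≤ η := (norm_nonneg _).trans hu
  have e : (u : D) * x * star (u : D) - y = (u : D) * (x - y) * star (u : D) +
      (((u : D) - 1) * y * star (u : D) + y * (star (u : D) - star 1)) := by
    rw [star_one]; noncomm_ring
  have h1 : ‖(u : D) * (x - y) * star (u : D)‖ = ‖x - y‖ := by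
    rw [CStarRing.norm_mul_mem_unitary _ (Unitary.star_mem u.2),
      CStarRing.norm_mem_unitary_mul _ u.2]
  have h2 : ‖((u : D) - 1) * y * star (u : D)‖ = ‖((u : D) - 1) * y‖ :=
    CStarRing.norm_mul_mem_unitary _ (Unitary.star_mem u.2)
  rw [e]
  refine (norm_add_le _ _).trans (add_le_add (h1.trans_le hx) ((norm_add_le _ _).trans ?_))
  have h3 := norm_mul_le ((u : D) - 1) y
  have h4 := norm_mul_le y (star (u : D) - star 1)
  rw [norm_star_sub_star] at h4
  rw [h2]
  nlinarith [norm_nonneg y, norm_nonneg ((u : D) - 1)]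

/-- `θ' : M_m(ℂ) → D` extends `θ : M_n(ℂ) → D` along the inclusion of the block diagonal copies of
these matrix algebras in the universal UHF algebra. -/
def ExtendsBlocks {n m : ℕ} [NeZero n] [NeZero m] (θ : Matrix (Fin n) (Fin n) ℂ →⋆ₐ[ℂ] D)
    (θ' : Matrix (Fin m) (Fin m) ℂ →⋆ₐ[ℂ] D) : Prop :=
  ∀ a, ∃ b, blockRep m b = blockRep n a ∧ θ' b = θ a

theorem ExtendsBlocks.trans {n m k : ℕ} [NeZero n] [NeZero m] [NeZero k]
    {θ : Matrix (Fin n) (Fin n) ℂ →⋆ₐ[ℂ] D} {θ' : Matrix (Fin m) (Fin m) ℂ →⋆ₐ[ℂ] D}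
    {θ'' : Matrix (Fin k) (Fin k) ℂ →⋆ₐ[ℂ] D} (h : ExtendsBlocks θ θ')
    (h' : ExtendsBlocks θ' θ'') : ExtendsBlocks θ θ'' := fun a => by
  obtain ⟨b, hb, hb'⟩ := h a
  obtain ⟨c, hc, hc'⟩ := h' b
  exact ⟨c, hc.trans hb, hc'.trans hb'⟩

theorem extendsBlocks_blockEmbedding {r n : ℕ} [NeZero n] [NeZero (r * n)]
    (θ : Matrix (Fin (r * n)) (Fin (r * n)) ℂ →⋆ₐ[ℂ] D) :
    ExtendsBlocks (θ.comp (blockEmbedding r n)) θ :=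
  fun a => ⟨blockEmbedding r n a, blockRep_blockEmbedding r n a, rfl⟩

open scoped Matrix.Norms.L2Operator in
/-- If `D` is locally approximated by matrix algebras, then every embedding of a matrix algebra
extends to one which approximates a given finite set. -/
theorem exists_extendsBlocks_approx [Nontrivial D]
    (happ : ∀ (F : Finset D) (ε : ℝ), 0 < ε → ∃ (l : ℕ) (θ : Matrix (Fin l) (Fin l) ℂ →⋆ₐ[ℂ] D),
      ∀ d ∈ F, ∃ a, ‖θ a - d‖ ≤ ε)
    {n : ℕ} [NeZero n] (θ : Matrix (Fin n) (Fin n) ℂ →⋆ₐ[ℂ] D) (F : Finset D) {ε : ℝ}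
    (hε : 0 < ε) :
    ∃ (m : ℕ) (_ : NeZero m) (θ' : Matrix (Fin m) (Fin m) ℂ →⋆ₐ[ℂ] D), ExtendsBlocks θ θ' ∧
      ∀ d ∈ F, ∃ a, ‖θ' a - d‖ ≤ ε := by
  classical
  set e : Fin n → Fin n → D := fun i j => θ (Matrix.single i j 1) with he
  have hem : IsMatrixUnits e := isMatrixUnits_map_single θ
  set N : ℝ := (n : ℝ) with hN
  have hN1 : 1 ≤ N := by
    rw [hN]; exact_mod_cast Nat.one_le_iff_ne_zero.2 (NeZero.ne n)
  set R : ℝ := ∑ d ∈ F, ‖d‖ with hR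
  have hR0 : 0 ≤ R := Finset.sum_nonneg fun _ _ => norm_nonneg _
  have hRd : ∀ d ∈ F, ‖d‖ ≤ R := fun d hd =>
    Finset.single_le_sum (f := fun d => ‖d‖) (fun _ _ => norm_nonneg _) hd
  -- The perturbed units are within `400 N δ`, and the smallness condition for conjugating them asks
  -- for `6 N` times this to be at most `1`. The conjugating unitary is within `2000 N² δ` of `1`,
  -- so conjugation moves `d` by at most `4000 N² δ ‖d‖`.
  obtain ⟨δ, hδ0, hδ1, hδ2⟩ : ∃ δ : ℝ, 0 < δ ∧ 2400 * (N * (N * δ)) ≤ 1 ∧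
      δ + 4000 * (N * (N * δ)) * R ≤ ε := by
    refine ⟨min (1 / (2400 * (N * N))) (ε / (1 + 4000 * (N * N) * R)), by positivity, ?_, ?_⟩
    · have h1 := min_le_left (1 / (2400 * (N * N))) (ε / (1 + 4000 * (N * N) * R))
      rw [le_div_iff₀ (by positivity)] at h1
      linarith
    · have h1 := min_le_right (1 / (2400 * (N * N))) (ε / (1 + 4000 * (N * N) * R))
      rw [le_div_iff₀ (by positivity)] at h1
      linarith
  -- The given matrix units join the finite set, so that the new matrix algebra almost contains
  -- them; a nearby unitary then makes the containment exact.
  obtain ⟨l, Θ, hΘ⟩ := happ (F ∪ Finset.univ.image fun i => e i 0) δ hδ0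
  have hΘF : ∀ d ∈ F, ∃ a, ‖Θ a - d‖ ≤ δ := fun d hd => hΘ d (Finset.mem_union_left _ hd)
  have hΘe : ∀ i, ∃ a, ‖Θ a - e i 0‖ ≤ δ := fun i =>
    hΘ _ (Finset.mem_union_right _ (Finset.mem_image_of_mem _ (Finset.mem_univ i)))
  choose x hx using hΘe
  have hNN : N * δ ≤ N * (N * δ) := by nlinarith [mul_pos (zero_lt_one.trans_le hN1) hδ0]
  obtain ⟨f, hf, hfe⟩ := hem.exists_near_of_column Θ (matrix_starAlgHom_injective Θ) 0 (δ := δ)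
    (by rw [Fintype.card_fin]; linarith [mul_pos (zero_lt_one.trans_le hN1) (mul_pos (zero_lt_one.trans_le hN1) hδ0)]) x hx
  rw [Fintype.card_fin] at hfe
  obtain ⟨w, hw1, hw⟩ := hem.exists_unitary_conj (hf.map Θ) 0 (δ := 400 * (N * δ))
    (by rw [Fintype.card_fin]; linarith) (fun i => hfe 0 i)
  rw [Fintype.card_fin] at hw1
  -- The copy of `M_n` found in `M_l` may sit in any position; `U` moves it to the block position
  -- that the universal UHF algebra requires.
  obtain ⟨r, rfl, U, hU⟩ := exists_conj_blockEmbedding hf.hom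
  have hl : NeZero (r * n) := ⟨fun h => by
    have h0 : (1 : Matrix (Fin (r * n)) (Fin (r * n)) ℂ) = 0 := by
      ext i
      exact absurd i.2 (by omega)
    have := congrArg Θ h0
    rw [map_one, map_zero] at this
    exact one_ne_zero this⟩
  obtain ⟨U, hUu⟩ := U
  have hfU : ∀ i j, f i j = U * blockEmbedding r n (Matrix.single i j 1) * star U := fun i j => by
    rw [← hf.hom_single, hU]; rfl
  set V : unitary D := w * ⟨Θ U, Unitary.map_mem Θ hUu⟩ with hV
  have hconj : ∀ a, StarAlgHom.conj V Θ a = (w : D) * Θ (U * a * star U) * star (w : D) := by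
    intro a
    rw [StarAlgHom.conj_apply, hV]
    simp only [map_mul, map_star, Submonoid.coe_mul, star_mul, mul_assoc]
  refine ⟨r * n, hl, StarAlgHom.conj V Θ, ?_, fun d hd => ?_⟩
  · have h1 : θ = (StarAlgHom.conj V Θ).comp (blockEmbedding r n) := by
      refine matrix_starAlgHom_ext fun i j => ?_
      change e i j = StarAlgHom.conj V Θ (blockEmbedding r n (Matrix.single i j 1))
      rw [hconj, ← hfU, hw]
    rw [h1]
    exact extendsBlocks_blockEmbedding _
  · obtain ⟨a, ha⟩ := hΘF d hd
    -- Conjugation by `U` only reparametrizes the matrix algebra; undoing it leaves the error due to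
    -- `w`.
    refine ⟨star U * a * U, ?_⟩
    have h1 : U * (star U * a * U) * star U = a := by
      rw [← mul_assoc, ← mul_assoc, (Unitary.mem_iff.1 hUu).2, one_mul, mul_assoc,
        (Unitary.mem_iff.1 hUu).2, mul_one]
    rw [hconj, h1]
    refine (norm_conj_sub_le w _ _ ha hw1).trans ?_
    refine le_trans ?_ hδ2
    have h3 := hRd d hd
    have h4 : 0 ≤ N * (N * δ) := by positivity
    nlinarith

/-- A matrix algebra unitally mapped to `D`. -/
structure MatrixStage (D : Type*) [CStarAlgebra D] where
  /-- The size of the matrices. -/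
  size : ℕ
  /-- The size is positive. -/
  [neZero : NeZero size]
  /-- The homomorphism. -/
  hom : Matrix (Fin size) (Fin size) ℂ →⋆ₐ[ℂ] D

attribute [instance] MatrixStage.neZero

/-- A separable C*-algebra which is locally approximated by matrix algebras, and which contains
every matrix algebra in a unique way up to unitary equivalence, is the universal UHF algebra. -/
theorem nonempty_starAlgEquiv_universalUHF [Nontrivial D] [TopologicalSpace.SeparableSpace D]
    (hex : ∀ n : ℕ, 1 ≤ n → Nonempty (Matrix (Fin n) (Fin n) ℂ →⋆ₐ[ℂ] D))
    (huniq : ∀ (n : ℕ) (θ θ' : Matrix (Fin n) (Fin n) ℂ →⋆ₐ[ℂ] D),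
      ∃ w : unitary D, θ' = StarAlgHom.conj w θ)
    (happ : ∀ (F : Finset D) (ε : ℝ), 0 < ε → ∃ (l : ℕ) (θ : Matrix (Fin l) (Fin l) ℂ →⋆ₐ[ℂ] D),
      ∀ d ∈ F, ∃ a, ‖θ a - d‖ ≤ ε) :
    Nonempty (D ≃⋆ₐ[ℂ] universalUHF) := by
  classical
  set x := TopologicalSpace.denseSeq D with hx
  have step : ∀ (k : ℕ) (s : MatrixStage D), ∃ t : MatrixStage D, ExtendsBlocks s.hom t.hom ∧
      (k + 1) ∣ t.size ∧ ∀ i ≤ k, ∃ a, ‖t.hom a - x i‖ ≤ 1 / (k + 1) := by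
    intro k s
    obtain ⟨m, hm, θ, hθ, hθx⟩ := exists_extendsBlocks_approx happ s.hom
      ((Finset.range (k + 1)).image x) (ε := 1 / (k + 1)) (by positivity)
    have hm' : NeZero ((k + 1) * m) := ⟨Nat.mul_ne_zero k.succ_ne_zero hm.out⟩
    -- The size is enlarged to a multiple of `k + 1`: some copy of the larger algebra exists, and by
    -- uniqueness a unitary carries its block subalgebra onto the given copy of `M_m`.
    obtain ⟨θ₁⟩ := hex ((k + 1) * m) (Nat.one_le_iff_ne_zero.2 hm'.out)
    obtain ⟨w, hw⟩ := huniq m (θ₁.comp (blockEmbedding (k + 1) m)) θ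
    have hext : ExtendsBlocks θ (StarAlgHom.conj w θ₁) := by
      have h1 : θ = (StarAlgHom.conj w θ₁).comp (blockEmbedding (k + 1) m) := hw
      rw [h1]
      exact extendsBlocks_blockEmbedding _
    refine ⟨⟨(k + 1) * m, StarAlgHom.conj w θ₁⟩, hθ.trans hext, Dvd.intro _ rfl, fun i hi => ?_⟩
    obtain ⟨a, ha⟩ := hθx (x i) (Finset.mem_image_of_mem _ (Finset.mem_range.2 (by omega)))
    obtain ⟨b, -, hb⟩ := hext a
    exact ⟨b, by rw [hb]; exact ha⟩
  choose next hnext hdvd hnear using step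
  obtain ⟨θ₀⟩ := hex 1 le_rfl
  set s : ℕ → MatrixStage D := fun k => Nat.rec ⟨1, θ₀⟩ next k with hs
  have hs1 : ∀ k, s (k + 1) = next k (s k) := fun k => rfl
  -- the graphs
  have hmem : ∀ (n : ℕ) [NeZero n] (a : Matrix (Fin n) (Fin n) ℂ), blockRep n a ∈ universalUHF := by
    intro n hn a
    obtain ⟨m, rfl⟩ := Nat.exists_eq_succ_of_ne_zero hn.out
    refine StarSubalgebra.le_topologicalClosure _ ?_
    exact le_iSup (fun n : ℕ => (blockRep (n + 1)).range) m ⟨a, rfl⟩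
  set ρ : ∀ k, Matrix (Fin (s k).size) (Fin (s k).size) ℂ →⋆ₐ[ℂ] universalUHF := fun k =>
    (blockRep (s k).size).codRestrict universalUHF (hmem _) with hρ
  set G : ℕ → StarSubalgebra ℂ (D × universalUHF) := fun k =>
    (StarAlgHom.prod (s k).hom (ρ k)).range with hG
  have hGmono : Monotone G := monotone_nat_of_le_succ fun k => by
    rintro _ ⟨a, rfl⟩
    obtain ⟨b, hb, hb'⟩ := hnext k (s k) a
    exact ⟨b, Prod.ext hb' (Subtype.ext hb)⟩
  have hGcoe : ((⨆ k, G k : StarSubalgebra ℂ (D × universalUHF)) : Set (D × universalUHF)) =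
      ⋃ k, (G k : Set (D × universalUHF)) :=
    StarSubalgebra.coe_iSup_of_directed hGmono.directed_le
  have hnt : Nontrivial universalUHF := ⟨⟨0, 1, fun h => by
    have h1 : (0 : EllTwo →L[ℂ] EllTwo) = 1 := congrArg Subtype.val h
    have h2 := congrArg (fun T : EllTwo →L[ℂ] EllTwo => T (ellBasis 0)) h1
    exact ellBasis.orthonormal.ne_zero 0 h2.symm⟩⟩
  refine nonempty_starAlgEquiv_of_isometric_graph (⨆ k, G k) ?_ ?_ ?_
  · intro y hy
    rw [← SetLike.mem_coe, hGcoe] at hy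
    obtain ⟨k, a, rfl⟩ := Set.mem_iUnion.1 hy
    exact norm_matrix_starAlgHom_eq (s k).hom (ρ k) a
  · rw [hGcoe]
    have hd : Dense (Set.range x) := TopologicalSpace.denseRange_denseSeq D
    rw [Metric.dense_iff]
    intro d r hr
    obtain ⟨_, hi, ⟨i, rfl⟩⟩ := Metric.dense_iff.1 hd d (r / 2) (by positivity)
    obtain ⟨j, hj⟩ := exists_nat_one_div_lt (show 0 < r / 2 by positivity)
    -- The stage must be late enough both to treat `x i` and to have tolerance below `r / 2`.
    obtain ⟨a, ha⟩ := hnear (max i j) (s (max i j)) i (le_max_left _ _)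
    refine ⟨(s (max i j + 1)).hom a, ?_, _, Set.mem_iUnion.2 ⟨max i j + 1, a, rfl⟩, rfl⟩
    rw [Metric.mem_ball] at hi ⊢
    have h1 : dist ((s (max i j + 1)).hom a) (x i) ≤ 1 / ((max i j : ℕ) + 1) := by
      rw [dist_eq_norm]; exact ha
    have h2 : (1 : ℝ) / ((max i j : ℕ) + 1) ≤ 1 / (j + 1) := by
      have : (j : ℝ) ≤ (max i j : ℕ) := by exact_mod_cast le_max_right i j
      gcongr
    have := dist_triangle ((s (max i j + 1)).hom a) (x i) d
    linarith
  · have hsub : ((⨆ n : ℕ, (blockRep (n + 1)).range : StarSubalgebra ℂ (EllTwo →L[ℂ] EllTwo)) :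
        Set (EllTwo →L[ℂ] EllTwo)) ⊆
        Subtype.val '' (Prod.snd '' (((⨆ k, G k : StarSubalgebra ℂ (D × universalUHF))) :
          Set (D × universalUHF))) := by
      have h1 : (⨆ n : ℕ, (blockRep (n + 1)).range) ≤
          ((⨆ k, G k).map (StarAlgHom.snd ℂ D universalUHF)).map universalUHF.subtype := by
        refine iSup_le fun n => ?_
        rintro _ ⟨a, rfl⟩
        -- Since `n + 1` divides the size of stage `n + 1`, the block copy of `M_{n+1}` lies in that
        -- stage.
        obtain ⟨c, hc⟩ := hdvd n (s n)
        have hsz : (s (n + 1)).size = c * (n + 1) := by rw [hs1, hc, mul_comm]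
        have hb : ∃ b, blockRep (s (n + 1)).size b = blockRep (n + 1) a := by
          have h2 : ∀ (m : ℕ) [NeZero m], m = c * (n + 1) →
              ∃ b, blockRep m b = blockRep (n + 1) a := by
            rintro m hm rfl
            exact ⟨_, blockRep_blockEmbedding c (n + 1) a⟩
          exact h2 _ hsz
        obtain ⟨b, hb⟩ := hb
        exact ⟨⟨_, hmem _ b⟩, ⟨((s (n + 1)).hom b, ⟨_, hmem _ b⟩),
          le_iSup G (n + 1) ⟨b, rfl⟩, rfl⟩, hb⟩
      exact h1
    rw [Subtype.dense_iff]
    intro y hy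
    exact closure_mono hsub hy

end UHFRecognition

/-! ### Slices of operators on a Hilbert space tensor product -/

section Slices

variable {H : Type*} [NormedAddCommGroup H] [InnerProductSpace ℂ H]
variable {K : Type*} [NormedAddCommGroup K] [InnerProductSpace ℂ K]

/-- The operator `η ↦ ξ ⊗ η`. -/
def tensorLeft (K : Type*) [NormedAddCommGroup K] [InnerProductSpace ℂ K] (ξ : H) :
    K →L[ℂ] HilbertTensor H K :=
  HilbertTensor.incl ∘L (TensorProduct.mk ℂ H K ξ).mkContinuous ‖ξ‖ fun η => by
    rw [TensorProduct.mk_apply, TensorProduct.norm_tmul]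

/-- The operator `ξ ↦ ξ ⊗ η`. -/
def tensorRight (H : Type*) [NormedAddCommGroup H] [InnerProductSpace ℂ H] (η : K) :
    H →L[ℂ] HilbertTensor H K :=
  HilbertTensor.incl ∘L ((TensorProduct.mk ℂ H K).flip η).mkContinuous ‖η‖ fun ξ => by
    rw [LinearMap.flip_apply, TensorProduct.mk_apply, TensorProduct.norm_tmul, mul_comm]

theorem tensorLeft_apply (ξ : H) (η : K) : tensorLeft K ξ η = HilbertTensor.incl (ξ ⊗ₜ η) := rfl

theorem opTensor_incl_tmul (S : H →L[ℂ] H) (T : K →L[ℂ] K) (ξ : H) (η : K) :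
    opTensor S T (HilbertTensor.incl (ξ ⊗ₜ η)) = HilbertTensor.incl (S ξ ⊗ₜ T η) := by
  rw [opTensor_incl, TensorProduct.mapL_tmul]

theorem norm_opTensor_le (S : H →L[ℂ] H) (T : K →L[ℂ] K) : ‖opTensor S T‖ ≤ ‖S‖ * ‖T‖ := by
  refine ContinuousLinearMap.opNorm_le_bound _ (by positivity) fun x => ?_
  refine HilbertTensor.denseRange_incl.induction_on (p := fun x =>
    ‖opTensor S T x‖ ≤ ‖S‖ * ‖T‖ * ‖x‖) x (isClosed_le (by fun_prop) (by fun_prop)) fun x => ?_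
  rw [opTensor_incl]
  change ‖((TensorProduct.mapL S T x : H ⊗[ℂ] K) : UniformSpace.Completion (H ⊗[ℂ] K))‖ ≤
    _ * ‖(x : UniformSpace.Completion (H ⊗[ℂ] K))‖
  rw [UniformSpace.Completion.norm_coe, UniformSpace.Completion.norm_coe]
  exact (ContinuousLinearMap.le_opNorm _ _).trans
    (mul_le_mul_of_nonneg_right (TensorProduct.norm_mapL_le S T) (norm_nonneg _))

theorem HilbertTensor.ext_of_inner_tmul {x y : HilbertTensor H K}
    (h : ∀ (ξ : H) (η : K), inner ℂ (HilbertTensor.incl (ξ ⊗ₜ η)) x =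
      inner ℂ (HilbertTensor.incl (ξ ⊗ₜ η)) y) : x = y := by
  refine ext_inner_left ℂ fun z => ?_
  refine HilbertTensor.denseRange_incl.induction_on (p := fun z => inner ℂ z x = inner ℂ z y) z
    (isClosed_eq (by fun_prop) (by fun_prop)) fun z => ?_
  induction z with
  | zero => simp
  | add a b ha hb => rw [map_add, inner_add_left, inner_add_left, ha, hb]
  | tmul a b => exact h a b

/-- The slice `(ω_{ξ', ξ} ⊗ id) y` of an operator `y` on `H ⊗ K`. -/
def sliceLeft [CompleteSpace K] (ξ' ξ : H) :
    (HilbertTensor H K →L[ℂ] HilbertTensor H K) →L[ℂ] (K →L[ℂ] K) :=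
  (ContinuousLinearMap.compL ℂ K (HilbertTensor H K) K
    (ContinuousLinearMap.adjoint (tensorLeft K ξ'))) ∘L
    ((ContinuousLinearMap.compL ℂ K (HilbertTensor H K) (HilbertTensor H K)).flip
      (tensorLeft K ξ))

/-- The slice `(id ⊗ ω_{η', η}) y` of an operator `y` on `H ⊗ K`. -/
def sliceRight [CompleteSpace H] (η' η : K) :
    (HilbertTensor H K →L[ℂ] HilbertTensor H K) →L[ℂ] (H →L[ℂ] H) :=
  (ContinuousLinearMap.compL ℂ H (HilbertTensor H K) H
    (ContinuousLinearMap.adjoint (tensorRight H η'))) ∘L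
    ((ContinuousLinearMap.compL ℂ H (HilbertTensor H K) (HilbertTensor H K)).flip
      (tensorRight H η))

theorem inner_sliceLeft [CompleteSpace K] (ξ' ξ : H) (η' η : K)
    (y : HilbertTensor H K →L[ℂ] HilbertTensor H K) :
    inner ℂ η' (sliceLeft ξ' ξ y η) =
      inner ℂ (HilbertTensor.incl (ξ' ⊗ₜ η')) (y (HilbertTensor.incl (ξ ⊗ₜ η))) := by
  change inner ℂ η' (ContinuousLinearMap.adjoint (tensorLeft K ξ') (y (tensorLeft K ξ η))) = _
  rw [ContinuousLinearMap.adjoint_inner_right]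
  rfl

theorem inner_sliceRight [CompleteSpace H] (ξ' ξ : H) (η' η : K)
    (y : HilbertTensor H K →L[ℂ] HilbertTensor H K) :
    inner ℂ ξ' (sliceRight η' η y ξ) =
      inner ℂ (HilbertTensor.incl (ξ' ⊗ₜ η')) (y (HilbertTensor.incl (ξ ⊗ₜ η))) := by
  change inner ℂ ξ' (ContinuousLinearMap.adjoint (tensorRight H η') (y (tensorRight H η ξ))) = _
  rw [ContinuousLinearMap.adjoint_inner_right]
  rfl

theorem sliceLeft_opTensor [CompleteSpace K] (ξ' ξ : H) (S : H →L[ℂ] H) (T : K →L[ℂ] K) :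
    sliceLeft ξ' ξ (opTensor S T) = inner ℂ ξ' (S ξ) • T := by
  refine ContinuousLinearMap.ext fun η => ext_inner_left ℂ fun η' => ?_
  rw [inner_sliceLeft, opTensor_incl_tmul, HilbertTensor.inner_incl, TensorProduct.inner_tmul,
    smul_apply, inner_smul_right]

theorem sliceRight_opTensor [CompleteSpace H] (η' η : K) (S : H →L[ℂ] H) (T : K →L[ℂ] K) :
    sliceRight η' η (opTensor S T) = inner ℂ η' (T η) • S := by
  refine ContinuousLinearMap.ext fun ξ => ext_inner_left ℂ fun ξ' => ?_
  rw [inner_sliceRight, opTensor_incl_tmul, HilbertTensor.inner_incl, TensorProduct.inner_tmul,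
    smul_apply, inner_smul_right, mul_comm]

theorem eq_zero_of_sliceRight [CompleteSpace H] {y : HilbertTensor H K →L[ℂ] HilbertTensor H K}
    (h : ∀ η' η, sliceRight η' η y = 0) : y = 0 := by
  refine HilbertTensor.op_ext fun x => ?_
  rw [zero_apply]
  induction x with
  | zero => simp
  | add a b ha hb => rw [map_add, map_add, ha, hb, add_zero]
  | tmul ξ η =>
    refine HilbertTensor.ext_of_inner_tmul fun ξ' η' => ?_
    rw [← inner_sliceRight, h, zero_apply, inner_zero_right, inner_zero_right]

theorem sliceLeft_star [CompleteSpace H] [CompleteSpace K] (ξ' ξ : H)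
    (y : HilbertTensor H K →L[ℂ] HilbertTensor H K) :
    sliceLeft ξ' ξ (star y) = star (sliceLeft ξ ξ' y) := by
  refine ContinuousLinearMap.ext fun η => ext_inner_left ℂ fun η' => ?_
  rw [inner_sliceLeft, ContinuousLinearMap.star_eq_adjoint, ContinuousLinearMap.star_eq_adjoint,
    ContinuousLinearMap.adjoint_inner_right, ContinuousLinearMap.adjoint_inner_right,
    ← inner_conj_symm, ← inner_sliceLeft, inner_conj_symm]

end Slices

/-! ### The spatial tensor product does not depend on the first representation -/

section ChangeOfRepresentation

/-- The span of a self-adjoint multiplicative set containing `1` is already a `*`-algebra. This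
allows membership to be tested with slice maps, which are only linear. -/
theorem mem_span_of_mem_adjoin {B : Type*} [Ring B] [StarRing B] [Algebra ℂ B] [StarModule ℂ B]
    {S : Set B} (h1 : 1 ∈ S) (hmul : ∀ x ∈ S, ∀ y ∈ S, x * y ∈ S) (hstar : ∀ x ∈ S, star x ∈ S)
    {x : B} (hx : x ∈ StarAlgebra.adjoin ℂ S) : x ∈ Submodule.span ℂ S := by
  have hspan : ∀ y ∈ Submodule.span ℂ S, star y ∈ Submodule.span ℂ S := fun y hy => by
    induction hy using Submodule.span_induction with
    | mem y hy => exact Submodule.subset_span (hstar y hy)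
    | zero => rw [star_zero]; exact zero_mem _
    | add y z _ _ hy hz => rw [star_add]; exact add_mem hy hz
    | smul c y _ hy => rw [star_smul]; exact Submodule.smul_mem _ _ hy
  induction hx using StarAlgebra.adjoin_induction with
  | mem x hx => exact Submodule.subset_span hx
  | algebraMap c =>
    rw [Algebra.algebraMap_eq_smul_one]
    exact Submodule.smul_mem _ _ (Submodule.subset_span h1)
  | add x y _ _ hx hy => exact add_mem hx hy
  | mul x y _ _ hx hy =>
    have h := Submodule.mul_mem_mul hx hy
    rw [Submodule.span_mul_span] at h
    refine Submodule.span_mono ?_ h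
    rintro _ ⟨a, ha, b, hb, rfl⟩
    exact hmul a ha b hb
  | star x _ hx => exact hspan x hx

variable {A : Type*} {B : Type*} [CStarAlgebra A] [CStarAlgebra B]
variable {H : Type*} [NormedAddCommGroup H] [InnerProductSpace ℂ H] [CompleteSpace H]
variable {H₀ : Type*} [NormedAddCommGroup H₀] [InnerProductSpace ℂ H₀] [CompleteSpace H₀]
variable {K : Type*} [NormedAddCommGroup K] [InnerProductSpace ℂ K] [CompleteSpace K]

theorem opTensor_map_star (π : A →⋆ₐ[ℂ] (H →L[ℂ] H)) (ρ : B →⋆ₐ[ℂ] (K →L[ℂ] K)) (a : A)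
    (b : B) : opTensor (π (star a)) (ρ (star b)) = star (opTensor (π a) (ρ b)) := by
  rw [map_star, map_star, opTensor_star]

theorem mem_closure_span_of_mem_spatialTensor (π : A →⋆ₐ[ℂ] (H →L[ℂ] H))
    (ρ : B →⋆ₐ[ℂ] (K →L[ℂ] K)) {y : HilbertTensor H K →L[ℂ] HilbertTensor H K}
    (hy : y ∈ spatialTensor π ρ) : y ∈ closure (Submodule.span ℂ
      (Set.range fun x : A × B => opTensor (π x.1) (ρ x.2)) :
        Set (HilbertTensor H K →L[ℂ] HilbertTensor H K)) := by
  rw [spatialTensor, ← SetLike.mem_coe, StarSubalgebra.topologicalClosure_coe] at hy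
  refine closure_mono (fun y hy => ?_) hy
  refine mem_span_of_mem_adjoin ?_ ?_ ?_ hy
  · exact ⟨1, by simp [opTensor_one]⟩
  · rintro _ ⟨x, rfl⟩ _ ⟨y, rfl⟩
    exact ⟨x * y, by simp [opTensor_mul]⟩
  · rintro _ ⟨x, rfl⟩
    exact ⟨star x, opTensor_map_star π ρ x.1 x.2⟩

theorem isClosed_range_of_injective {f : A →⋆ₐ[ℂ] B} (hf : Function.Injective f) :
    IsClosed (Set.range f) :=
  (NonUnitalStarAlgHom.isometry f hf).isClosedEmbedding.isClosed_range

/-- A slice of an elementary tensor is a scalar multiple of some `ρ b`, slices are linear and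
continuous, and the range of the faithful `ρ` is closed. -/
theorem sliceLeft_mem_range (π : A →⋆ₐ[ℂ] (H →L[ℂ] H)) {ρ : B →⋆ₐ[ℂ] (K →L[ℂ] K)}
    (hρ : Function.Injective ρ) {y : HilbertTensor H K →L[ℂ] HilbertTensor H K}
    (hy : y ∈ spatialTensor π ρ) (ξ' ξ : H) : sliceLeft ξ' ξ y ∈ ρ.range := by
  have hcl : IsClosed {y : HilbertTensor H K →L[ℂ] HilbertTensor H K |
      sliceLeft ξ' ξ y ∈ Set.range ρ} :=
    (isClosed_range_of_injective hρ).preimage (sliceLeft ξ' ξ).continuous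
  refine closure_minimal ?_ hcl (mem_closure_span_of_mem_spatialTensor π ρ hy)
  change Submodule.span ℂ _ ≤
    (Subalgebra.toSubmodule ρ.range.toSubalgebra).comap (sliceLeft ξ' ξ).toLinearMap
  rw [Submodule.span_le]
  rintro _ ⟨x, rfl⟩
  change sliceLeft ξ' ξ (opTensor (π x.1) (ρ x.2)) ∈ ρ.range
  rw [sliceLeft_opTensor]
  exact SMulMemClass.smul_mem _ ⟨x.2, rfl⟩

/-- If `π` is faithful then `π a ⊗ ρ b ↦ σ a ⊗ ρ b` defines a `*`-homomorphism of spatial tensor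
products. -/
theorem exists_spatialTensor_changeRep {π : A →⋆ₐ[ℂ] (H →L[ℂ] H)} (hπ : Function.Injective π)
    (σ : A →⋆ₐ[ℂ] (H₀ →L[ℂ] H₀)) (ρ : B →⋆ₐ[ℂ] (K →L[ℂ] K)) :
    ∃ T : spatialTensor π ρ →⋆ₐ[ℂ] (HilbertTensor H₀ K →L[ℂ] HilbertTensor H₀ K),
      (∀ x, T x ∈ spatialTensor σ ρ) ∧
      ∀ a b, T ⟨opTensor (π a) (ρ b), opTensor_mem_spatialTensor π ρ a b⟩ =
        opTensor (σ a) (ρ b) := by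
  set B₁ := HilbertTensor H K →L[ℂ] HilbertTensor H K
  set B₂ := HilbertTensor H₀ K →L[ℂ] HilbertTensor H₀ K
  set gen : A × B → B₁ × B₂ := fun x => (opTensor (π x.1) (ρ x.2), opTensor (σ x.1) (ρ x.2))
    with hgen
  set G := (StarAlgebra.adjoin ℂ (Set.range gen)).topologicalClosure with hG
  have hGcl : IsClosed (G : Set (B₁ × B₂)) := StarSubalgebra.isClosed_topologicalClosure _
  have hgenG : ∀ x, gen x ∈ G := fun x =>
    StarSubalgebra.le_topologicalClosure _ (StarAlgebra.subset_adjoin ℂ _ ⟨x, rfl⟩)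
  have hspan : ∀ y ∈ G, y ∈ closure (Submodule.span ℂ (Set.range gen) : Set (B₁ × B₂)) := by
    intro y hy
    rw [hG, ← SetLike.mem_coe, StarSubalgebra.topologicalClosure_coe] at hy
    refine closure_mono (fun y hy => ?_) hy
    refine mem_span_of_mem_adjoin ?_ ?_ ?_ hy
    · exact ⟨1, by simp [hgen, opTensor_one]⟩
    · rintro _ ⟨x, rfl⟩ _ ⟨y, rfl⟩
      exact ⟨x * y, by simp [hgen, opTensor_mul]⟩
    · rintro _ ⟨x, rfl⟩
      exact ⟨star x, Prod.ext (opTensor_map_star π ρ x.1 x.2) (opTensor_map_star σ ρ x.1 x.2)⟩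
  set πσ : A →⋆ₐ[ℂ] (H →L[ℂ] H) × (H₀ →L[ℂ] H₀) := StarAlgHom.prod π σ with hπσ
  -- Both coordinates of an element of `G` have slices coming from one `a : A`. Faithfulness of `π`
  -- then lets vanishing pass from the first coordinate to the second, so `G` is the graph of a map.
  have hslice : ∀ y ∈ G, ∀ η' η, ∃ a, sliceRight η' η y.1 = π a ∧ sliceRight η' η y.2 = σ a := by
    intro y hy η' η
    set L : B₁ × B₂ →L[ℂ] (H →L[ℂ] H) × (H₀ →L[ℂ] H₀) :=
      (sliceRight η' η).prodMap (sliceRight η' η) with hL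
    have hinj : Function.Injective πσ := fun a b hab => hπ (congrArg Prod.fst hab)
    have hcl : IsClosed {y | L y ∈ Set.range πσ} :=
      (isClosed_range_of_injective hinj).preimage L.continuous
    have h1 : y ∈ {y | L y ∈ Set.range πσ} := by
      refine closure_minimal ?_ hcl (hspan y hy)
      change Submodule.span ℂ _ ≤
        (Subalgebra.toSubmodule πσ.range.toSubalgebra).comap L.toLinearMap
      rw [Submodule.span_le]
      rintro _ ⟨x, rfl⟩
      refine ⟨(inner ℂ η' (ρ x.2 η)) • x.1, ?_⟩
      change πσ _ = L (gen x)
      rw [map_smul]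
      exact Prod.ext (sliceRight_opTensor η' η (π x.1) (ρ x.2)).symm
        (sliceRight_opTensor η' η (σ x.1) (ρ x.2)).symm
    obtain ⟨a, ha⟩ := h1
    exact ⟨a, (congrArg Prod.fst ha).symm, (congrArg Prod.snd ha).symm⟩
  let _ : CStarAlgebra G := StarSubalgebra.cstarAlgebra G (h_closed := hGcl)
  set f : G →⋆ₐ[ℂ] B₁ := (StarAlgHom.fst ℂ B₁ B₂).comp G.subtype with hf
  have hfi : Function.Injective f := by
    rw [injective_iff_map_eq_zero]
    intro y hy
    have hy1 : (y : B₁ × B₂).1 = 0 := hy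
    have hy2 : (y : B₁ × B₂).2 = 0 := by
      refine eq_zero_of_sliceRight fun η' η => ?_
      obtain ⟨a, ha, ha'⟩ := hslice y y.2 η' η
      rw [hy1, map_zero] at ha
      have : a = 0 := hπ (by rw [← ha, map_zero])
      rw [ha', this, map_zero]
    exact Subtype.ext (Prod.ext hy1 hy2)
  have hle : spatialTensor π ρ ≤ f.range := by
    refine StarSubalgebra.topologicalClosure_minimal (StarAlgebra.adjoin_le ?_)
      (isClosed_range_of_injective hfi)
    rintro _ ⟨x, rfl⟩
    exact ⟨⟨gen x, hgenG x⟩, rfl⟩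
  have hG2 : G ≤ (spatialTensor σ ρ).comap (StarAlgHom.snd ℂ B₁ B₂) := by
    refine StarSubalgebra.topologicalClosure_minimal (StarAlgebra.adjoin_le ?_)
      ((StarSubalgebra.isClosed_topologicalClosure _).preimage continuous_snd)
    rintro _ ⟨x, rfl⟩
    exact opTensor_mem_spatialTensor σ ρ x.1 x.2
  refine ⟨((StarAlgHom.snd ℂ B₁ B₂).comp G.subtype).comp
    (((StarAlgEquiv.ofInjective f hfi).symm : f.range →⋆ₐ[ℂ] G).comp
      (StarSubalgebra.inclusion hle)), fun x => hG2 (Subtype.property _), fun a b => ?_⟩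
  have h1 : (StarAlgEquiv.ofInjective f hfi).symm (StarSubalgebra.inclusion hle
      ⟨opTensor (π a) (ρ b), opTensor_mem_spatialTensor π ρ a b⟩) = ⟨gen (a, b), hgenG (a, b)⟩ := by
    rw [StarAlgEquiv.symm_apply_eq]
    rfl
  exact congrArg (fun y : G => (y : B₁ × B₂).2) h1

end ChangeOfRepresentation

/-! ### Compressions of the first tensor factor to finite rank projections -/

section Compression

variable {H : Type*} [NormedAddCommGroup H] [InnerProductSpace ℂ H]
variable {K : Type*} [NormedAddCommGroup K] [InnerProductSpace ℂ K] [CompleteSpace K]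
variable {l : ℕ} {e : Fin l → H} {P : H →L[ℂ] H}

theorem opTensor_one_eq_sum (hP : ∀ x, P x = ∑ i, inner ℂ (e i) x • e i) :
    opTensor P (1 : K →L[ℂ] K) =
      ∑ k, tensorLeft K (e k) ∘L ContinuousLinearMap.adjoint (tensorLeft K (e k)) := by
  have hadj : ∀ (k : Fin l) (ξ : H) (η : K), ContinuousLinearMap.adjoint (tensorLeft K (e k))
      (HilbertTensor.incl (ξ ⊗ₜ η)) = inner ℂ (e k) ξ • η := by
    intro k ξ η
    refine ext_inner_left ℂ fun ζ => ?_
    rw [ContinuousLinearMap.adjoint_inner_right, tensorLeft_apply, HilbertTensor.inner_incl,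
      TensorProduct.inner_tmul, inner_smul_right]
  refine HilbertTensor.op_ext fun x => ?_
  induction x with
  | zero => simp
  | add a b ha hb => rw [map_add, map_add, map_add, ha, hb]
  | tmul ξ η =>
    rw [opTensor_incl_tmul, hP, sum_apply, TensorProduct.sum_tmul, map_sum]
    refine Finset.sum_congr rfl fun k _ => ?_
    rw [ContinuousLinearMap.comp_apply, hadj, map_smul, tensorLeft_apply,
      ← TensorProduct.smul_tmul', map_smul]
    rfl

/-- Slices along an orthonormal basis are operator-valued matrix coefficients; with `P ⊗ 1` between
the factors, this is matrix multiplication. -/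
theorem sliceLeft_mul_mul (hP : ∀ x, P x = ∑ i, inner ℂ (e i) x • e i) (ξ' ξ : H)
    (y z : HilbertTensor H K →L[ℂ] HilbertTensor H K) :
    sliceLeft ξ' ξ (y * opTensor P 1 * z) =
      ∑ k, sliceLeft ξ' (e k) y * sliceLeft (e k) ξ z := by
  have h1 : y * opTensor P (1 : K →L[ℂ] K) * z = ∑ k, y * (tensorLeft K (e k) ∘L
      ContinuousLinearMap.adjoint (tensorLeft K (e k))) * z := by
    rw [opTensor_one_eq_sum hP, Finset.mul_sum, Finset.sum_mul]
  rw [h1, map_sum]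
  rfl

theorem sliceLeft_mul_right {P : H →L[ℂ] H} {ξ : H} (hξ : P ξ = ξ) (ξ' : H)
    (y : HilbertTensor H K →L[ℂ] HilbertTensor H K) :
    sliceLeft ξ' ξ (y * opTensor P 1) = sliceLeft ξ' ξ y := by
  refine ContinuousLinearMap.ext fun η => ext_inner_left ℂ fun η' => ?_
  rw [inner_sliceLeft, inner_sliceLeft, mul_apply_eq_comp, opTensor_incl_tmul, hξ]
  rfl

theorem sliceLeft_mul_left [CompleteSpace H] {P : H →L[ℂ] H} (hPs : star P = P)
    {ξ' : H} (hξ : P ξ' = ξ') (ξ : H)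
    (y : HilbertTensor H K →L[ℂ] HilbertTensor H K) :
    sliceLeft ξ' ξ (opTensor P 1 * y) = sliceLeft ξ' ξ y := by
  have h1 : star (opTensor P (1 : K →L[ℂ] K)) = opTensor P 1 := by
    rw [← opTensor_star, hPs, star_one]
  have h2 : opTensor P 1 * y = star (star y * opTensor P 1) := by rw [star_mul, h1, star_star]
  rw [h2, sliceLeft_star, sliceLeft_mul_right hξ, sliceLeft_star, star_star]

/-- For a finite rank projection `P` with orthonormal basis `e`, the operators on `H ⊗ K` which
commute with `P ⊗ 1` and have slices in `ρ(D)` form a C*-algebra, and matrix units commuting with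
the range of `τ` give a `*`-homomorphism from it to `D`. -/
theorem exists_compression_hom [CompleteSpace H] {D : Type*} [CStarAlgebra D]
    {ρ : D →⋆ₐ[ℂ] (K →L[ℂ] K)}
    (hρ : Function.Injective ρ) (he : Orthonormal ℂ e) (hPs : IsStarProjection P)
    (hP : ∀ x, P x = ∑ i, inner ℂ (e i) x • e i) {g : Fin l → Fin l → D} (hg : IsMatrixUnits g)
    (τ : D →⋆ₐ[ℂ] D) (hgτ : ∀ i j d, Commute (g i j) (τ d)) :
    ∃ (C : StarSubalgebra ℂ (HilbertTensor H K →L[ℂ] HilbertTensor H K)) (κ : C →⋆ₐ[ℂ] D),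
      IsClosed (C : Set (HilbertTensor H K →L[ℂ] HilbertTensor H K)) ∧
      (∀ y, y ∈ C ↔ Commute y (opTensor P 1) ∧ ∀ i j, ∃ d, ρ d = sliceLeft (e i) (e j) y) ∧
      ∀ (y : C) (a : Fin l → Fin l → D), (∀ i j, ρ (a i j) = sliceLeft (e i) (e j) y) →
        κ y = ∑ i, ∑ j, g i j * τ (a i j) := by
  have hPe : ∀ i, P (e i) = e i := fun i => by
    rw [hP]
    simp only [orthonormal_iff_ite.1 he, ite_smul, one_smul, zero_smul]
    simp
  have hp : opTensor P (1 : K →L[ℂ] K) * opTensor P 1 = opTensor P 1 := by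
    rw [← opTensor_mul, hPs.isIdempotentElem, one_mul]
  have hps : star (opTensor P (1 : K →L[ℂ] K)) = opTensor P 1 := by
    rw [← opTensor_star, star_one, hPs.isSelfAdjoint.star_eq]
  -- Commutation with `P ⊗ 1` inserts the projection between the factors, making the compression
  -- multiplicative.
  have hsl : ∀ (y z : HilbertTensor H K →L[ℂ] HilbertTensor H K), Commute y (opTensor P 1) →
      ∀ i j, sliceLeft (e i) (e j) (y * z) =
        ∑ k, sliceLeft (e i) (e k) y * sliceLeft (e k) (e j) z := by
    intro y z hy i j
    rw [← sliceLeft_mul_mul hP, hy.eq, mul_assoc, sliceLeft_mul_left hPs.isSelfAdjoint (hPe i)]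
  have hone : ∀ i j, sliceLeft (e i) (e j) (1 : HilbertTensor H K →L[ℂ] HilbertTensor H K) =
      if i = j then 1 else 0 := fun i j => by
    rw [← opTensor_one, sliceLeft_opTensor, one_apply_eq_self,
      orthonormal_iff_ite.1 he]
    split_ifs <;> simp
  have hsc : ∀ (c : ℂ) i j, ρ (if i = j then algebraMap ℂ D c else 0) = sliceLeft (e i) (e j)
      (algebraMap ℂ (HilbertTensor H K →L[ℂ] HilbertTensor H K) c) := by
    intro c i j
    rw [Algebra.algebraMap_eq_smul_one (A := HilbertTensor H K →L[ℂ] HilbertTensor H K), map_smul,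
      hone]
    split_ifs
    · rw [AlgHomClass.commutes, Algebra.algebraMap_eq_smul_one]
    · rw [map_zero, smul_zero]
  let C : StarSubalgebra ℂ (HilbertTensor H K →L[ℂ] HilbertTensor H K) :=
    { carrier := {y | Commute y (opTensor P 1) ∧
        ∀ i j, ∃ d, ρ d = sliceLeft (e i) (e j) y}
      mul_mem' := by
        rintro y z ⟨hy, hy'⟩ ⟨hz, hz'⟩
        refine ⟨hy.mul_left hz, fun i j => ?_⟩
        choose a ha using hy'
        choose b hb using hz'
        exact ⟨∑ k, a i k * b k j, by simp only [map_sum, map_mul, ha, hb, hsl y z hy]⟩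
      add_mem' := by
        rintro y z ⟨hy, hy'⟩ ⟨hz, hz'⟩
        refine ⟨hy.add_left hz, fun i j => ?_⟩
        obtain ⟨a, ha⟩ := hy' i j
        obtain ⟨b, hb⟩ := hz' i j
        exact ⟨a + b, by rw [map_add, map_add, ha, hb]⟩
      algebraMap_mem' := fun c => ⟨Algebra.commutes c _, fun i j => ⟨_, hsc c i j⟩⟩
      star_mem' := by
        rintro y ⟨hy, hy'⟩
        refine ⟨?_, fun i j => ?_⟩
        · have := hy.star_star
          rwa [hps] at this
        · obtain ⟨a, ha⟩ := hy' j i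
          exact ⟨star a, by rw [map_star, ha, sliceLeft_star]⟩ }
  have hmem : ∀ y, y ∈ C ↔ Commute y (opTensor P 1) ∧
    ∀ i j, ∃ d, ρ d = sliceLeft (e i) (e j) y := fun y => Iff.rfl
  have hex : ∀ y : C, ∀ i j, ∃ d, ρ d = sliceLeft (e i) (e j) (y : _ →L[ℂ] _) := fun y => y.2.2
  choose a ha using hex
  have haeq : ∀ (y : C) i j (d : D), ρ d = sliceLeft (e i) (e j) (y : _ →L[ℂ] _) → a y i j = d :=
    fun y i j d hd => hρ ((ha y i j).trans hd.symm)
  have hasc : ∀ (c : ℂ) i j, a (algebraMap ℂ C c) i j = if i = j then algebraMap ℂ D c else 0 :=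
    fun c i j => haeq _ i j _ (hsc c i j)
  have hκsc : ∀ c : ℂ, ∑ i, ∑ j, g i j * τ (a (algebraMap ℂ C c) i j) = algebraMap ℂ D c := by
    intro c
    simp only [hasc, apply_ite τ, map_zero, mul_ite, mul_zero, Finset.sum_ite_eq,
      Finset.mem_univ, if_true]
    rw [← Finset.sum_mul, hg.sum_eq, one_mul, AlgHomClass.commutes]
  -- On the compressed corner, identified with matrices over `D`, this is the tensor product of the
  -- homomorphism given by `g` with `τ`; commuting ranges make it multiplicative.
  let κ : C →⋆ₐ[ℂ] D :=
    { toFun := fun y => ∑ i, ∑ j, g i j * τ (a y i j)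
      map_one' := by
        have := hκsc 1
        rwa [map_one, map_one] at this
      map_zero' := by
        have := hκsc 0
        rwa [map_zero, map_zero] at this
      map_add' := fun y z => by
        have h1 : ∀ i j, a (y + z) i j = a y i j + a z i j := fun i j => haeq _ _ _ _ (by
          rw [map_add, ha, ha, ← map_add]; rfl)
        simp only [h1, map_add, mul_add, Finset.sum_add_distrib]
      map_mul' := fun y z => by
        have h1 : ∀ i j, a (y * z) i j = ∑ k, a y i k * a z k j := fun i j => haeq _ _ _ _ (by
          simp only [map_sum, map_mul, ha]
          exact (hsl _ _ y.2.1 i j).symm)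
        have h2 : ∀ i j k m, g i j * τ (a y i j) * (g k m * τ (a z k m)) =
            if j = k then g i m * (τ (a y i j) * τ (a z k m)) else 0 := by
          intro i j k m
          calc _ = g i j * (τ (a y i j) * g k m) * τ (a z k m) := by simp only [mul_assoc]
            _ = (g i j * g k m) * (τ (a y i j) * τ (a z k m)) := by
                rw [← (hgτ k m (a y i j)).eq]; simp only [mul_assoc]
            _ = _ := by rw [hg.mul_eq]; split_ifs <;> simp
        simp only [h1, map_sum, map_mul, Finset.sum_mul]
        refine Finset.sum_congr rfl fun i _ => ?_
        simp only [Finset.mul_sum, h2]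
        rw [Finset.sum_comm]
        refine Finset.sum_congr rfl fun j _ => ?_
        rw [Finset.sum_comm]
        simp
      commutes' := hκsc
      map_star' := fun y => by
        have h1 : ∀ i j, a (star y) i j = star (a y j i) := fun i j => haeq _ _ _ _ (by
          rw [map_star, ha, ← sliceLeft_star]; rfl)
        simp only [h1, star_sum, star_mul, map_star, hg.star_eq]
        rw [Finset.sum_comm]
        refine Finset.sum_congr rfl fun i _ => Finset.sum_congr rfl fun j _ => ?_
        rw [← map_star, (hgτ _ _ _).eq] }
  refine ⟨C, κ, ?_, hmem, fun y b hb => ?_⟩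
  · have h1 : (C : Set (HilbertTensor H K →L[ℂ] HilbertTensor H K)) =
        {y | y * opTensor P 1 = opTensor P 1 * y} ∩
          ⋂ i, ⋂ j, sliceLeft (e i) (e j) ⁻¹' Set.range ρ := by
      ext y
      simp only [Set.mem_inter_iff, Set.mem_iInter]
      exact hmem y
    rw [h1]
    refine (isClosed_eq (by fun_prop) (by fun_prop)).inter
      (isClosed_iInter fun i => isClosed_iInter fun j => ?_)
    exact (isClosed_range_of_injective hρ).preimage (sliceLeft (e i) (e j)).continuous
  · change ∑ i, ∑ j, g i j * τ (a y i j) = _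
    simp only [haeq y _ _ _ (hb _ _)]

/-- Compressing a unitary which almost commutes with a projection. -/
theorem norm_compression_sub_le {B : Type*} [CStarAlgebra B] {p U M N : B} {δ : ℝ}
    (hp : IsStarProjection p) (hU : U ∈ unitary B) (hpU : ‖p * U - U * p‖ ≤ δ)
    (hN : p * N = N * p) (hM : ‖U * N * star U - M‖ ≤ δ) :
    ‖star (p * U * p + (1 - p)) * (p * U * p + (1 - p)) - 1‖ ≤ δ ∧
    ‖(p * U * p + (1 - p)) * star (p * U * p + (1 - p)) - 1‖ ≤ δ ∧
    ‖(p * U * p + (1 - p)) * (p * N * p) * star (p * U * p + (1 - p)) - p * M * p‖ ≤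
      δ * (‖N‖ + 1) := by
  have hpp : p * p = p := hp.isIdempotentElem
  have hps : star p = p := hp.isSelfAdjoint
  have hδ0 : 0 ≤ δ := (norm_nonneg _).trans hpU
  obtain ⟨hU1, hU2⟩ := Unitary.mem_iff.1 hU
  have hUn : ‖U‖ ≤ 1 := by
    rcases subsingleton_or_nontrivial B with h | h
    · rw [Subsingleton.elim U 0, norm_zero]; exact zero_le_one
    · exact (CStarRing.norm_of_mem_unitary hU).le
  have hUn' : ‖star U‖ ≤ 1 := by rwa [norm_star]
  have hpn : ‖p‖ ≤ 1 := by
    have := CStarRing.norm_star_mul_self (x := p)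
    rw [hps, hpp] at this
    nlinarith [norm_nonneg p]
  have h3 : ∀ {a b c : B} {s t : ℝ}, ‖a‖ ≤ 1 → ‖b‖ ≤ s → ‖c‖ ≤ t → 0 ≤ s →
      ‖a * b * c‖ ≤ s * t := by
    intro a b c s t ha hb hc hs
    refine (norm_mul_le _ _).trans (mul_le_mul ((norm_mul_le _ _).trans ?_) hc (norm_nonneg _) hs)
    nlinarith [norm_nonneg a, norm_nonneg b]
  -- Adding `1 - p` turns an almost unitary of the corner into an almost unitary of the whole
  -- algebra, so all errors are governed by the commutator of `p` and `U`.
  have hcs : star (p * U * p + (1 - p)) = p * star U * p + (1 - p) := by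
    simp [hps, mul_assoc]
  have hq : (1 - p) * (1 - p) = 1 - p := by
    rw [mul_sub, mul_one, sub_mul, one_mul, hpp, sub_self, sub_zero]
  have hpq : p * (1 - p) = 0 := by rw [mul_sub, mul_one, hpp, sub_self]
  have hqp : (1 - p) * p = 0 := by rw [sub_mul, one_mul, hpp, sub_self]
  have hcc : ∀ a b : B, (p * a * p + (1 - p)) * (p * b * p + (1 - p)) =
      p * a * p * b * p + (1 - p) := by
    intro a b
    calc _ = p * a * (p * p) * b * p + p * a * (p * (1 - p)) + ((1 - p) * p) * b * p +
          (1 - p) * (1 - p) := by noncomm_ring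
      _ = _ := by rw [hpp, hpq, hqp, hq]; noncomm_ring
  have hpUp : ‖U * p - p * U‖ ≤ δ := by rwa [norm_sub_rev]
  rw [hcs]
  refine ⟨?_, ?_, ?_⟩
  · rw [hcc]
    have e : p * star U * p * U * p + (1 - p) - 1 = (p * star U) * (p * U - U * p) * p := by
      calc _ = p * star U * p * U * p - p * 1 * p + (p * p - p) := by noncomm_ring
        _ = p * star U * p * U * p - p * (star U * U) * (p * p) := by
          rw [hU1, hpp]; noncomm_ring
        _ = _ := by noncomm_ring
    rw [e]
    refine (h3 ((norm_mul_le _ _).trans (mul_le_one₀ hpn (norm_nonneg _) hUn')) hpU hpn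
      hδ0).trans (mul_one δ).le
  · rw [hcc]
    have e : p * U * p * star U * p + (1 - p) - 1 = p * (U * p - p * U) * (star U * p) := by
      calc _ = p * U * p * star U * p - p * 1 * p + (p * p - p) := by noncomm_ring
        _ = p * U * p * star U * p - (p * p) * (U * star U) * p := by
          rw [hU2, hpp]; noncomm_ring
        _ = _ := by noncomm_ring
    rw [e]
    refine (h3 hpn hpUp ((norm_mul_le _ _).trans (mul_le_one₀ hUn' (norm_nonneg _) hpn))
      hδ0).trans (mul_one δ).le
  · have e : (p * U * p + (1 - p)) * (p * N * p) * (p * star U * p + (1 - p)) - p * M * p =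
        p * (U * p - p * U) * (N * star U * p) + p * (U * N * star U - M) * p := by
      calc _ = (p * U * (p * p) + (1 - p) * p) * N * ((p * p) * star U * p + p * (1 - p)) -
            p * M * p := by noncomm_ring
        _ = p * U * (p * N) * p * star U * p - p * M * p := by rw [hpp, hpq, hqp]; noncomm_ring
        _ = p * U * (p * N) * star U * p - p * M * p := by
          have : p * N * p = p * N := by rw [hN, mul_assoc, hpp]
          rw [mul_assoc (p * U), this]
        _ = p * U * p * N * star U * p - (p * p) * U * N * star U * p +
            p * U * N * star U * p - p * M * p := by rw [hpp]; noncomm_ring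
        _ = _ := by noncomm_ring
    rw [e]
    refine (norm_add_le _ _).trans ?_
    have h4 : ‖N * star U * p‖ ≤ ‖N‖ := by
      refine (norm_mul_le _ _).trans ?_
      have := norm_mul_le N (star U)
      nlinarith [norm_nonneg (N * star U), norm_nonneg N, norm_nonneg p, norm_nonneg (star U)]
    have h5 := h3 hpn hpUp h4 hδ0
    have h6 := h3 hpn hM hpn hδ0
    linarith

end Compression

/-! ### Local approximation by matrix algebras -/

section LocalApproximation

variable {D : Type u} [CStarAlgebra D]

/-- A net indexed by finite sets and accuracies, so no countability is needed. Keeping `ξ` out of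
the kernels guarantees nonzero rank. -/
theorem exists_quasicentral_projections {H : Type*} [NormedAddCommGroup H] [InnerProductSpace ℂ H]
    [CompleteSpace H] {σ : D →⋆ₐ[ℂ] (H →L[ℂ] H)} (hσ : IsQuasidiagonalSet (Set.range σ)) {ξ : H}
    (hξ : ξ ≠ 0) :
    ∃ P : Finset D × ℕ → H →L[ℂ] H, (∀ i, IsStarProjection (P i)) ∧
      (∀ i, FiniteDimensional ℂ (LinearMap.range (P i).toLinearMap)) ∧ (∀ i, P i ξ ≠ 0) ∧
      ∀ d, Tendsto (fun i => P i * σ d - σ d * P i) atTop (𝓝 0) := by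
  classical
  have h : ∀ i : Finset D × ℕ, ∃ P : H →L[ℂ] H, IsStarProjection P ∧
      FiniteDimensional ℂ (LinearMap.range P.toLinearMap) ∧ P ξ ≠ 0 ∧
      ∀ d ∈ i.1, ‖P * σ d - σ d * P‖ ≤ 1 / (i.2 + 1) := by
    rintro ⟨F, n⟩
    have hpos : 0 < min (1 / ((n : ℝ) + 1)) ‖ξ‖ := lt_min (by positivity) (norm_pos_iff.2 hξ)
    obtain ⟨P, hP, hfin, hPF, hPξ⟩ := hσ (F.image σ) {ξ} _ (by
      rw [Finset.coe_image]; exact Set.image_subset_range _ _) hpos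
    refine ⟨P, hP, hfin, fun h0 => ?_, fun d hd => ?_⟩
    · have h1 := (hPξ ξ (Finset.mem_singleton_self ξ)).trans_le (min_le_right _ _)
      rw [h0, zero_sub, norm_neg] at h1
      exact lt_irrefl _ h1
    · exact ((hPF _ (Finset.mem_image_of_mem _ hd)).trans_le (min_le_left _ _)).le
  choose P hP hfin hξ' hPF using h
  refine ⟨P, hP, hfin, hξ', fun d => ?_⟩
  rw [Metric.tendsto_atTop]
  intro ε hε
  obtain ⟨n, hn⟩ := exists_nat_one_div_lt hε
  refine ⟨({d}, n), fun i hi => ?_⟩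
  rw [dist_zero_right]
  refine (hPF i d (hi.1 (Finset.mem_singleton_self d))).trans_lt (lt_of_le_of_lt ?_ hn)
  have : (n : ℝ) ≤ i.2 := by exact_mod_cast hi.2
  gcongr

theorem IsStarProjection.norm_le_one {A : Type*} [CStarAlgebra A] {p : A}
    (hp : IsStarProjection p) : ‖p‖ ≤ 1 := by
  have := CStarRing.norm_star_mul_self (x := p)
  rw [hp.isSelfAdjoint.star_eq, hp.isIdempotentElem] at this
  nlinarith [norm_nonneg p]

theorem isStarProjection_opTensor_one {H : Type*} [NormedAddCommGroup H] [InnerProductSpace ℂ H]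
    [CompleteSpace H] {K : Type*} [NormedAddCommGroup K] [InnerProductSpace ℂ K] [CompleteSpace K]
    {P : H →L[ℂ] H} (hP : IsStarProjection P) :
    IsStarProjection (opTensor P (1 : K →L[ℂ] K)) where
  isIdempotentElem := by rw [IsIdempotentElem, ← opTensor_mul, hP.isIdempotentElem, one_mul]
  isSelfAdjoint := by
    rw [IsSelfAdjoint, ← opTensor_star, star_one, hP.isSelfAdjoint.star_eq]

/-- Projections which are asymptotically central for a representation of `D` are asymptotically
central for the spatial tensor product. -/
theorem tendsto_commutator_opTensor {B : Type*} [CStarAlgebra B] {H : Type*}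
    [NormedAddCommGroup H] [InnerProductSpace ℂ H] [CompleteSpace H] {K : Type*}
    [NormedAddCommGroup K] [InnerProductSpace ℂ K] [CompleteSpace K] {σ : D →⋆ₐ[ℂ] (H →L[ℂ] H)}
    (ρ : B →⋆ₐ[ℂ] (K →L[ℂ] K)) {ι : Type*} {f : Filter ι} {P : ι → H →L[ℂ] H}
    (hP : ∀ i, IsStarProjection (P i))
    (hPσ : ∀ d, Tendsto (fun i => P i * σ d - σ d * P i) f (𝓝 0))
    {y : HilbertTensor H K →L[ℂ] HilbertTensor H K} (hy : y ∈ spatialTensor σ ρ) :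
    Tendsto (fun i => opTensor (P i) 1 * y - y * opTensor (P i) 1) f (𝓝 0) := by
  have hspan : ∀ z ∈ Submodule.span ℂ (Set.range fun x : D × B => opTensor (σ x.1) (ρ x.2)),
      Tendsto (fun i => opTensor (P i) 1 * z - z * opTensor (P i) 1) f (𝓝 0) := by
    intro z hz
    induction hz using Submodule.span_induction with
    | mem z hz =>
      obtain ⟨x, rfl⟩ := hz
      have e : ∀ i, opTensor (P i) 1 * opTensor (σ x.1) (ρ x.2) -
          opTensor (σ x.1) (ρ x.2) * opTensor (P i) 1 =
          opTensor (P i * σ x.1 - σ x.1 * P i) (ρ x.2) := fun i => by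
        rw [← opTensor_mul, ← opTensor_mul, one_mul, mul_one, sub_eq_iff_eq_add,
          ← opTensor_add_left, sub_add_cancel]
      simp only [e]
      refine squeeze_zero_norm (fun i => norm_opTensor_le _ _) ?_
      have := (hPσ x.1).norm.mul_const ‖ρ x.2‖
      rwa [norm_zero, zero_mul] at this
    | zero => simp [tendsto_const_nhds]
    | add a b _ _ ha hb =>
      have := ha.add hb
      rw [add_zero] at this
      refine this.congr fun i => ?_
      noncomm_ring
    | smul c a _ ha =>
      have := ha.const_smul c
      rw [smul_zero] at this
      refine this.congr fun i => ?_
      rw [smul_sub, mul_smul_comm, smul_mul_assoc]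
  rw [Metric.tendsto_nhds]
  intro ε hε
  -- Commutators with a projection at most double norms, so approximation within `ε / 4` costs at
  -- most `ε / 2`.
  obtain ⟨z, hz, hyz⟩ := Metric.mem_closure_iff.1
    (mem_closure_span_of_mem_spatialTensor σ ρ hy) (ε / 4) (by positivity)
  filter_upwards [Metric.tendsto_nhds.1 (hspan z hz) (ε / 4) (by positivity)] with i hi
  rw [dist_zero_right] at hi ⊢
  rw [dist_eq_norm] at hyz
  have hp := (isStarProjection_opTensor_one (K := K) (hP i)).norm_le_one
  set p := opTensor (P i) (1 : K →L[ℂ] K)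
  have e : p * y - y * p = (p * z - z * p) + (p * (y - z) - (y - z) * p) := by noncomm_ring
  rw [e]
  have h1 := norm_add_le (p * z - z * p) (p * (y - z) - (y - z) * p)
  have h2 := norm_sub_le (p * (y - z)) ((y - z) * p)
  have h3 := norm_mul_le p (y - z)
  have h4 := norm_mul_le (y - z) p
  nlinarith [norm_nonneg p, norm_nonneg (y - z)]

theorem exists_orthonormal_range {H : Type*} [NormedAddCommGroup H] [InnerProductSpace ℂ H]
    [CompleteSpace H] {P : H →L[ℂ] H} (hP : IsStarProjection P)
    [FiniteDimensional ℂ (LinearMap.range P.toLinearMap)] :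
    ∃ (l : ℕ) (e : Fin l → H), Orthonormal ℂ e ∧ ∀ x, P x = ∑ i, inner ℂ (e i) x • e i := by
  set W := LinearMap.range P.toLinearMap
  set b := stdOrthonormalBasis ℂ W
  refine ⟨_, fun i => (b i : H), b.orthonormal.comp_linearIsometry W.subtypeₗᵢ, fun x => ?_⟩
  have hPb : ∀ i, P (b i : H) = b i := fun i => by
    obtain ⟨y, hy⟩ := (b i).2
    rw [← hy]
    exact congrArg (fun T : H →L[ℂ] H => T y) hP.isIdempotentElem
  have hPx : P x ∈ W := ⟨x, rfl⟩
  have h1 := congrArg Subtype.val (b.sum_repr' ⟨P x, hPx⟩)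
  have h2 : ∀ i, inner ℂ (b i : H) (P x) = inner ℂ (b i : H) x := fun i => by
    have h3 : ContinuousLinearMap.adjoint P = P := hP.isSelfAdjoint
    conv_lhs => rw [← h3]
    rw [ContinuousLinearMap.adjoint_inner_right, hPb]
  have h4 : ∑ i, inner ℂ (b i : H) (P x) • (b i : H) = P x := by simpa using h1
  rw [← h4]
  exact Finset.sum_congr rfl fun i _ => by rw [h2]

theorem exists_spatialInr {A B : Type*} [CStarAlgebra A] [CStarAlgebra B] {H : Type*}
    [NormedAddCommGroup H] [InnerProductSpace ℂ H] [CompleteSpace H] {K : Type*}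
    [NormedAddCommGroup K] [InnerProductSpace ℂ K] [CompleteSpace K] (π : A →⋆ₐ[ℂ] (H →L[ℂ] H))
    (ρ : B →⋆ₐ[ℂ] (K →L[ℂ] K)) :
    ∃ j : B →⋆ₐ[ℂ] spatialTensor π ρ, ∀ b, (j b : HilbertTensor H K →L[ℂ] HilbertTensor H K) =
      opTensor 1 (ρ b) := by
  have hmem : ∀ b, opTensor (1 : H →L[ℂ] H) (ρ b) ∈ spatialTensor π ρ := fun b => by
    have := opTensor_mem_spatialTensor π ρ 1 b
    rwa [map_one] at this
  have hadd : ∀ T T' : K →L[ℂ] K, opTensor (1 : H →L[ℂ] H) (T + T') =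
      opTensor 1 T + opTensor 1 T' := fun T T' => by
    refine HilbertTensor.op_ext fun x => ?_
    rw [add_apply, opTensor_incl, opTensor_incl, opTensor_incl, TensorProduct.mapL_add_right,
      add_apply, map_add]
  have hsmul : ∀ (c : ℂ) (T : K →L[ℂ] K), opTensor (1 : H →L[ℂ] H) (c • T) =
      c • opTensor 1 T := fun c T => by
    refine HilbertTensor.op_ext fun x => ?_
    rw [smul_apply, opTensor_incl, opTensor_incl, TensorProduct.mapL_smul_right, smul_apply,
      map_smul]
  refine ⟨StarAlgHom.codRestrict
    { toFun := fun b => opTensor (1 : H →L[ℂ] H) (ρ b)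
      map_one' := by rw [map_one, opTensor_one]
      map_mul' := fun a b => by rw [map_mul, ← opTensor_mul, one_mul]
      map_zero' := by
        rw [map_zero]
        simpa using hsmul 0 0
      map_add' := fun a b => by rw [map_add, hadd]
      commutes' := fun c => by
        rw [AlgHomClass.commutes, Algebra.algebraMap_eq_smul_one, hsmul, opTensor_one,
          ← Algebra.algebraMap_eq_smul_one]
      map_star' := fun b => by rw [map_star, ← opTensor_star, star_one] } _ hmem, fun b => rfl⟩

/-- A tensor square decomposition of `D`, seen from within `D`: the two factor embeddings `α`, `β`
have commuting ranges, and `α` is approximately inner. -/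
structure TensorSquare (D : Type u) [CStarAlgebra D] where
  /-- The first factor embedding. -/
  α : D →⋆ₐ[ℂ] D
  /-- The second factor embedding. -/
  β : D →⋆ₐ[ℂ] D
  /-- The unitaries implementing `α`. -/
  w : ℕ → unitary D
  commute : ∀ a b, Commute (α a) (β b)
  tendsto : ∀ d, Tendsto (fun n => ‖(w n : D) * d * star (w n : D) - α d‖) atTop (𝓝 0)

theorem matrix_starAlgHom_apply {n A : Type*} [Fintype n] [DecidableEq n] [Ring A] [StarRing A]
    [Algebra ℂ A] (θ : Matrix n n ℂ →⋆ₐ[ℂ] A) (a : Matrix n n ℂ) :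
    θ a = ∑ i, ∑ j, a i j • θ (Matrix.single i j 1) := by
  conv_lhs => rw [Matrix.matrix_eq_sum_single a]
  simp only [map_sum]
  refine Finset.sum_congr rfl fun i _ => Finset.sum_congr rfl fun j _ => ?_
  rw [← map_smul, Matrix.smul_single, smul_eq_mul, mul_one]

-- Cutting down by `Q ⊗ 1` gives elements of `M_l ⊗ D`, on which `κ = θ ⊗ α` is defined. It sends
-- the cut-down of `1 ⊗ ρ d` to `α d` and that of `σ d' ⊗ 1` to `θ` of a scalar matrix. Being
-- contractive, `κ` carries the approximate conjugation by `U` into `D`, where polar decomposition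
-- replaces `κ c` by a unitary.
set_option maxHeartbeats 400000 in
theorem exists_unitary_of_compression {H : Type*} [NormedAddCommGroup H] [InnerProductSpace ℂ H]
    [CompleteSpace H] {K : Type*} [NormedAddCommGroup K] [InnerProductSpace ℂ K] [CompleteSpace K]
    {σ : D →⋆ₐ[ℂ] (H →L[ℂ] H)} {ρ : D →⋆ₐ[ℂ] (K →L[ℂ] K)} (hρ : Function.Injective ρ)
    {U : HilbertTensor H K →L[ℂ] HilbertTensor H K} (hU : U ∈ spatialTensor σ ρ)
    (hUu : U ∈ unitary (HilbertTensor H K →L[ℂ] HilbertTensor H K)) {l : ℕ} {e : Fin l → H}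
    (he : Orthonormal ℂ e) {Q : H →L[ℂ] H} (hQs : IsStarProjection Q)
    (hQsum : ∀ x, Q x = ∑ i, inner ℂ (e i) x • e i) (α : D →⋆ₐ[ℂ] D)
    (θ : Matrix (Fin l) (Fin l) ℂ →⋆ₐ[ℂ] D) (hαθ : ∀ d a, Commute (α d) (θ a)) {δ : ℝ}
    (hδ : δ ≤ 1 / 2) (hQU : ‖opTensor Q 1 * U - U * opTensor Q 1‖ ≤ δ) :
    ∃ v : unitary D, ∀ d d', ‖U * opTensor 1 (ρ d) * star U - opTensor (σ d') 1‖ ≤ δ →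
      ∃ a, ‖(v : D) * α d * star (v : D) - θ a‖ ≤ δ * (7 * ‖d‖ + 1) := by
  have hQe : ∀ j, Q (e j) = e j := fun j => by
    rw [hQsum]
    simp only [orthonormal_iff_ite.1 he, ite_smul, one_smul, zero_smul]
    simp
  have hg : IsMatrixUnits fun j k => θ (Matrix.single j k 1) := isMatrixUnits_map_single θ
  obtain ⟨C, κ, hCcl, hCmem, hκ⟩ := exists_compression_hom hρ he hQs hQsum hg α
    fun j k d => (hαθ d _).symm
  let _ : CStarAlgebra C := StarSubalgebra.cstarAlgebra C (h_closed := hCcl)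
  set p := opTensor Q (1 : K →L[ℂ] K) with hp
  have hpp : IsStarProjection p := isStarProjection_opTensor_one hQs
  have hpcomm : ∀ y, Commute (p * y * p) p := fun y => by
    have h1 : p * p = p := hpp.isIdempotentElem
    rw [Commute, SemiconjBy, mul_assoc, h1, mul_assoc p (y) p, ← mul_assoc p p, h1]
  have hpsl : ∀ y j k, sliceLeft (e j) (e k) (p * y * p) = sliceLeft (e j) (e k) y :=
    fun y j k => by
      rw [hp, sliceLeft_mul_right (hQe k), sliceLeft_mul_left hQs.isSelfAdjoint (hQe j)]
  -- the compressed unitary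
  have hc : p * U * p + (1 - p) ∈ C := by
    rw [hCmem]
    refine ⟨(hpcomm U).add_left ((Commute.one_left p).sub_left (Commute.refl p)), fun j k => ?_⟩
    have h1 : sliceLeft (e j) (e k) (1 - p) = 0 := by
      have h2 := hpsl 1 j k
      rw [mul_one, hpp.isIdempotentElem] at h2
      rw [map_sub, h2, sub_self]
    rw [map_add, hpsl, h1, add_zero]
    exact sliceLeft_mem_range σ hρ hU (e j) (e k)
  have hslN : ∀ d j k, sliceLeft (e j) (e k) (p * opTensor 1 (ρ d) * p) =
      ρ (if j = k then d else 0) := fun d j k => by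
    rw [hpsl, sliceLeft_opTensor, one_apply_eq_self, orthonormal_iff_ite.1 he]
    split_ifs <;> simp
  have hN : ∀ d, p * opTensor 1 (ρ d) * p ∈ C := fun d =>
    (hCmem _).2 ⟨hpcomm _, fun j k => ⟨_, (hslN d j k).symm⟩⟩
  have hκN : ∀ d, κ ⟨_, hN d⟩ = α d := fun d => by
    rw [hκ ⟨_, hN d⟩ (fun j k => if j = k then d else 0) fun j k => (hslN d j k).symm]
    simp only [apply_ite α, map_zero, mul_ite, mul_zero, Finset.sum_ite_eq, Finset.mem_univ,
      if_true]
    rw [← Finset.sum_mul, hg.sum_eq, one_mul]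
  have hslM : ∀ d j k, sliceLeft (e j) (e k) (p * opTensor (σ d) (1 : K →L[ℂ] K) * p) =
      ρ (inner ℂ (e j) (σ d (e k)) • (1 : D)) := fun d j k => by
    rw [hpsl, sliceLeft_opTensor, map_smul, map_one]
  have hM : ∀ d, p * opTensor (σ d) 1 * p ∈ C := fun d =>
    (hCmem _).2 ⟨hpcomm _, fun j k => ⟨_, (hslM d j k).symm⟩⟩
  have hκM : ∀ d, κ ⟨_, hM d⟩ = θ (Matrix.of fun j k => inner ℂ (e j) (σ d (e k))) :=
    fun d => by
      rw [hκ ⟨_, hM d⟩ (fun j k => inner ℂ (e j) (σ d (e k)) • (1 : D))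
        fun j k => (hslM d j k).symm, matrix_starAlgHom_apply]
      simp only [map_smul, map_one, mul_smul_comm, mul_one]
      rfl
  set c : C := ⟨_, hc⟩ with hcdef
  have hκn : ∀ y : C, ‖κ y‖ ≤ ‖(y : HilbertTensor H K →L[ℂ] HilbertTensor H K)‖ := fun y =>
    NonUnitalStarAlgHom.norm_apply_le κ y
  have hpNc : ∀ d, p * opTensor 1 (ρ d) = opTensor 1 (ρ d) * p := fun d => by
    rw [hp, ← opTensor_mul, ← opTensor_mul, one_mul, mul_one, one_mul, mul_one]
  have hδ0 : 0 ≤ δ := (norm_nonneg _).trans hQU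
  have hsub : ∀ a b : C, ‖κ a - κ b‖ ≤ ‖(a : HilbertTensor H K →L[ℂ] HilbertTensor H K) - b‖ :=
    fun a b => by
      rw [← map_sub]
      exact hκn _
  -- The almost unitarity of `c` involves neither `N` nor `M`; dummy zeros give it before `d` and
  -- `d'` are known, so one unitary serves all of them.
  obtain ⟨hc1, hc2, -⟩ := norm_compression_sub_le (N := 0) (M := 0) hpp hUu hQU (by simp)
    (by simpa using hδ0)
  have hκ1 : ‖star (κ c) * κ c - 1‖ ≤ δ := by
    rw [← map_star, ← map_mul, ← map_one κ]
    exact (hsub _ _).trans hc1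
  have hκ2 : ‖κ c * star (κ c) - 1‖ ≤ δ := by
    rw [← map_star, ← map_mul, ← map_one κ]
    exact (hsub _ _).trans hc2
  obtain ⟨r, hr1, -, hru⟩ := exists_unitary_mul_near_one hδ hκ1 hκ2
  refine ⟨⟨_, hru⟩, fun d d' hdd' => ⟨Matrix.of fun j k => inner ℂ (e j) (σ d' (e k)), ?_⟩⟩
  obtain ⟨-, -, h3⟩ := norm_compression_sub_le hpp hUu hQU (hpNc d) hdd'
  have hNd : ‖opTensor (1 : H →L[ℂ] H) (ρ d)‖ ≤ ‖d‖ := by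
    refine (norm_opTensor_le _ _).trans ?_
    have h4 : ‖(1 : H →L[ℂ] H)‖ ≤ 1 := ContinuousLinearMap.norm_id_le
    have h5 : ‖ρ d‖ ≤ ‖d‖ := NonUnitalStarAlgHom.norm_apply_le ρ d
    nlinarith [norm_nonneg (1 : H →L[ℂ] H), norm_nonneg (ρ d)]
  have h4 : ‖κ c * α d * star (κ c) - θ (Matrix.of fun j k => inner ℂ (e j) (σ d' (e k)))‖ ≤
      δ * (‖d‖ + 1) := by
    rw [← hκM, ← hκN, ← map_star, ← map_mul, ← map_mul]
    refine (hsub _ _).trans (h3.trans ?_)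
    gcongr
  have hαd : ‖α d‖ ≤ ‖d‖ := NonUnitalStarAlgHom.norm_apply_le α d
  have hκc : ‖κ c‖ ≤ 2 := by
    have h5 := CStarRing.norm_star_mul_self (x := κ c)
    have h6 := norm_add_le (star (κ c) * κ c - 1) 1
    have h7 : ‖(1 : D)‖ ≤ 1 := (IsStarProjection.one D).norm_le_one
    rw [sub_add_cancel, h5] at h6
    nlinarith [norm_nonneg (κ c)]
  set w := κ c * r with hw
  have hwc : ‖w - κ c‖ ≤ 2 * δ := by
    have e1 : w - κ c = κ c * (r - 1) := by rw [hw, mul_sub, mul_one]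
    rw [e1]
    refine (norm_mul_le _ _).trans ?_
    nlinarith [norm_nonneg (κ c), norm_nonneg (r - 1)]
  have hwn : ‖w‖ ≤ 1 := by
    rcases subsingleton_or_nontrivial D with h | h
    · rw [Subsingleton.elim w 0, norm_zero]; exact zero_le_one
    · exact (CStarRing.norm_of_mem_unitary hru).le
  have e1 : w * α d * star w - θ (Matrix.of fun j k => inner ℂ (e j) (σ d' (e k))) =
      (κ c * α d * star (κ c) - θ (Matrix.of fun j k => inner ℂ (e j) (σ d' (e k)))) +
      ((w - κ c) * α d * star w + κ c * α d * star (w - κ c)) := by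
    rw [star_sub]; noncomm_ring
  have h5 : ‖(w - κ c) * α d * star w‖ ≤ 2 * δ * ‖d‖ := by
    refine (norm_mul_le _ _).trans ?_
    rw [norm_star]
    have := norm_mul_le (w - κ c) (α d)
    have h6 : ‖w - κ c‖ * ‖α d‖ ≤ 2 * δ * ‖d‖ := by gcongr
    nlinarith [norm_nonneg ((w - κ c) * α d), norm_nonneg w]
  have h6 : ‖κ c * α d * star (w - κ c)‖ ≤ 2 * ‖d‖ * (2 * δ) := by
    refine (norm_mul_le _ _).trans ?_
    rw [norm_star]
    have := norm_mul_le (κ c) (α d)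
    have h6 : ‖κ c‖ * ‖α d‖ ≤ 2 * ‖d‖ := by gcongr
    exact mul_le_mul (this.trans h6) hwc (norm_nonneg _) (by positivity)
  change ‖w * α d * star w - _‖ ≤ _
  rw [e1]
  -- The constant `7` is `1 + 2 + 4`: the compression error and the two errors from replacing `κ c`
  -- by the unitary `w`.
  refine (norm_add_le _ _).trans ((add_le_add h4 ((norm_add_le _ _).trans (add_le_add h5 h6))).trans
    ?_)
  linarith

end LocalApproximation

/-! ### Approximating the first tensor factor by means of quasidiagonality -/

section LocalApproximation

variable {D : Type u} [CStarAlgebra D]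

set_option maxHeartbeats 400000 in
/-- A strongly self-absorbing quasidiagonal C*-algebra has a tensor square decomposition such that
the first factor is, up to conjugation by unitaries and on finite sets, approximately contained in
matrix algebras of the second factor. -/
theorem exists_tensorSquare_approx [Nontrivial D] (hssa : IsStronglySelfAbsorbing D)
    (hqd : IsQuasidiagonal D) :
    ∃ S : TensorSquare D, ∀ (F : Finset D) (ε : ℝ), 0 < ε → ∃ l : ℕ, 1 ≤ l ∧
      ∀ θ : Matrix (Fin l) (Fin l) ℂ →⋆ₐ[ℂ] D, ∃ v : unitary D, ∀ d ∈ F, ∃ a,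
        ‖(v : D) * S.α d * star (v : D) - S.β (θ a)‖ ≤ ε := by
  obtain ⟨-, H, _, _, _, K, _, _, _, π, ρ, hπ, hρ, φ, u, hu⟩ := hssa
  obtain ⟨H₀, _, _, _, σ, hσ, hσq⟩ := hqd
  obtain ⟨inr, hinr⟩ := exists_spatialInr π ρ
  have hcomm : ∀ a b, Commute (spatialInl π ρ a) (inr b) := fun a b => by
    refine Subtype.ext ?_
    change opTensor (π a) 1 * (inr b : HilbertTensor H K →L[ℂ] HilbertTensor H K) =
      (inr b : HilbertTensor H K →L[ℂ] HilbertTensor H K) * opTensor (π a) 1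
    rw [hinr, ← opTensor_mul, ← opTensor_mul, one_mul, mul_one, one_mul, mul_one]
  have hφn : ∀ x : spatialTensor π ρ, ‖φ.symm x‖ = ‖x‖ := fun x =>
    NonUnitalStarAlgHom.norm_map (φ.symm : spatialTensor π ρ →⋆ₐ[ℂ] D) φ.symm.injective x
  set α : D →⋆ₐ[ℂ] D := (φ.symm : spatialTensor π ρ →⋆ₐ[ℂ] D).comp (spatialInl π ρ) with hα
  set β : D →⋆ₐ[ℂ] D := (φ.symm : spatialTensor π ρ →⋆ₐ[ℂ] D).comp inr with hβ
  have hφβ : ∀ d, φ (β d) = inr d := fun d => φ.apply_symm_apply _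
  have hαβ : ∀ a b, Commute (α a) (β b) := fun a b =>
    (hcomm a b).map (φ.symm : spatialTensor π ρ →⋆ₐ[ℂ] D)
  let S : TensorSquare D :=
    { α := α
      β := β
      w := fun n => ⟨φ.symm (u n), Unitary.map_mem (φ.symm : spatialTensor π ρ →⋆ₐ[ℂ] D) (u n).2⟩
      commute := hαβ
      tendsto := fun d => by
        refine (hu d).congr fun n => ?_
        rw [← hφn, map_sub, map_mul, map_mul, map_star]
        change ‖φ.symm (u n) * φ.symm (φ d) * star (φ.symm (u n)) - α d‖ = _
        rw [φ.symm_apply_apply] }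
  refine ⟨S, fun F ε hε => ?_⟩
  -- The representation `π` from self-absorption need not be quasidiagonal, so the first factor is
  -- transported to `σ`.
  obtain ⟨T, hTmem, hT⟩ := exists_spatialTensor_changeRep hπ σ ρ
  -- the accuracy
  set R : ℝ := ∑ d ∈ F, ‖d‖ with hR
  have hR0 : 0 ≤ R := Finset.sum_nonneg fun _ _ => norm_nonneg _
  have hRd : ∀ d ∈ F, ‖d‖ ≤ R := fun d hd =>
    Finset.single_le_sum (f := fun d => ‖d‖) (fun _ _ => norm_nonneg _) hd
  obtain ⟨δ, hδ0, hδ1, hδ2⟩ : ∃ δ : ℝ, 0 < δ ∧ δ ≤ 1 / 2 ∧ δ * (7 * R + 1) ≤ ε := by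
    refine ⟨min (1 / 2) (ε / (7 * R + 1)), by positivity, min_le_left _ _, ?_⟩
    rw [← le_div_iff₀ (by positivity)]
    exact min_le_right _ _
  -- a unitary of the tensor square which moves the second factor to the first one
  obtain ⟨m, hm⟩ : ∃ m, ∀ d ∈ F, ‖(u m : spatialTensor π ρ) * inr d * star (u m : spatialTensor π ρ)
      - spatialInl π ρ (β d)‖ < δ := by
    have h1 : ∀ᶠ m in atTop, ∀ d ∈ F, ‖(u m : spatialTensor π ρ) * inr d *
        star (u m : spatialTensor π ρ) - spatialInl π ρ (β d)‖ < δ := by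
      rw [Filter.eventually_all_finset]
      intro d _
      -- The approximate equivalence is evaluated at `β d` because `φ (β d) = 1 ⊗ d`: the same
      -- unitaries thereby move the second factor into the first.
      have h2 := (hu (β d)).eventually (gt_mem_nhds hδ0)
      filter_upwards [h2] with m hm
      rw [← hφβ]
      exact hm
    exact h1.exists
  set U := T (u m) with hU
  have hUu : U ∈ unitary (HilbertTensor H₀ K →L[ℂ] HilbertTensor H₀ K) :=
    Unitary.map_mem T (u m).2
  have hTinr : ∀ d, T (inr d) = opTensor 1 (ρ d) := fun d => by
    have h1 : inr d = ⟨opTensor (π 1) (ρ d), opTensor_mem_spatialTensor π ρ 1 d⟩ :=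
      Subtype.ext ((hinr d).trans (congrArg (opTensor · (ρ d)) (map_one π).symm))
    rw [h1, hT, map_one]
  have hTinl : ∀ d, T (spatialInl π ρ d) = opTensor (σ d) 1 := fun d => by
    have h1 : spatialInl π ρ d = ⟨opTensor (π d) (ρ 1), opTensor_mem_spatialTensor π ρ d 1⟩ :=
      Subtype.ext (congrArg (opTensor (π d)) (map_one ρ).symm)
    rw [h1, hT, map_one]
  have hTn : ∀ x, ‖T x‖ ≤ ‖x‖ := fun x => NonUnitalStarAlgHom.norm_apply_le T x
  have hUF : ∀ d ∈ F, ‖U * opTensor 1 (ρ d) * star U - opTensor (σ (β d)) 1‖ ≤ δ := fun d hd => by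
    rw [hU, ← hTinr, ← hTinl, ← map_star, ← map_mul, ← map_mul, ← map_sub]
    exact (hTn _).trans (hm d hd).le
  -- a finite rank projection which almost commutes with the unitary
  obtain ⟨ξ, hξ⟩ : ∃ ξ : H₀, ξ ≠ 0 := by
    by_contra! h
    have h1 : (1 : H₀ →L[ℂ] H₀) = 0 := ContinuousLinearMap.ext fun x => h _
    rw [← map_one σ, ← map_zero σ] at h1
    exact one_ne_zero (hσ h1)
  classical
  obtain ⟨P, hP, hfin, hPξ, hPσ⟩ := exists_quasicentral_projections hσq hξ
  have hPU := tendsto_commutator_opTensor ρ hP hPσ (hTmem (u m))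
  obtain ⟨i, hi⟩ := ((tendsto_zero_iff_norm_tendsto_zero.1 hPU).eventually
    (gt_mem_nhds hδ0)).exists
  have := hfin i
  obtain ⟨l, e, he, hPe⟩ := exists_orthonormal_range (hP i)
  refine ⟨l, ?_, fun θ => ?_⟩
  · rw [Nat.one_le_iff_ne_zero]
    rintro rfl
    exact hPξ i (by rw [hPe]; rfl)
  -- The matrix algebra enters through `β ∘ θ`, whose range commutes with that of `α` for every
  -- choice of `θ`.
  obtain ⟨v, hv⟩ := exists_unitary_of_compression hρ (hTmem (u m)) hUu he (hP i) hPe α (β.comp θ)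
    (fun d a => hαβ d _) hδ1 hi.le
  refine ⟨v, fun d hd => ?_⟩
  obtain ⟨a, ha⟩ := hv d (β d) (hUF d hd)
  refine ⟨a, ha.trans (le_trans ?_ hδ2)⟩
  have := hRd d hd
  gcongr

end LocalApproximation

/-! ### Uniqueness of embeddings of matrix algebras -/

section Uniqueness

/-- The element `∑ e i j * f j i` is the flip of `M_n ⊗ M_n`, a self-adjoint unitary exchanging the
two factors. -/
theorem exists_flip_unitary {n A : Type*} [Fintype n] [DecidableEq n] [Ring A] [StarRing A]
    {e f : n → n → A} (he : IsMatrixUnits e) (hf : IsMatrixUnits f)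
    (hef : ∀ i j k l, Commute (e i j) (f k l)) :
    ∃ s : unitary A, ∀ i j, f i j = s * e i j * star (s : A) := by
  set s : A := ∑ i, ∑ j, e i j * f j i with hs
  have hse : ∀ k l, s * e k l = ∑ i, e i l * f k i := fun k l => by
    rw [hs, Finset.sum_mul]
    refine Finset.sum_congr rfl fun i _ => ?_
    rw [Finset.sum_mul, Finset.sum_eq_single k]
    · rw [mul_assoc, ← (hef k l k i).eq, ← mul_assoc, he.mul_eq, if_pos rfl]
    · intro j _ hj
      rw [mul_assoc, ← (hef k l j i).eq, ← mul_assoc, he.mul_eq, if_neg hj, zero_mul]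
    · simp
  have hfs : ∀ k l, f k l * s = ∑ i, e i l * f k i := fun k l => by
    rw [hs, Finset.mul_sum]
    refine Finset.sum_congr rfl fun i _ => ?_
    rw [Finset.mul_sum, Finset.sum_eq_single l]
    · rw [← mul_assoc, ← (hef i l k l).eq, mul_assoc, hf.mul_eq, if_pos rfl]
    · intro j _ hj
      rw [← mul_assoc, ← (hef i j k l).eq, mul_assoc, hf.mul_eq, if_neg hj.symm, mul_zero]
    · simp
  have hstar : star s = s := by
    rw [hs]
    simp only [star_sum, star_mul, he.star_eq, hf.star_eq]
    rw [Finset.sum_comm]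
    exact Finset.sum_congr rfl fun i _ => Finset.sum_congr rfl fun j _ => ((hef _ _ _ _).eq).symm
  have hss : s * s = 1 := by
    have h1 : s * s = ∑ k, ∑ l, (s * e k l) * f l k := by
      conv_lhs => rw [hs, Finset.mul_sum]
      simp only [Finset.mul_sum, mul_assoc, ← hs]
    have h2 : ∀ k l, (s * e k l) * f l k = e l l * f k k := fun k l => by
      rw [hse, Finset.sum_mul, Finset.sum_eq_single l]
      · rw [mul_assoc, hf.mul_eq, if_pos rfl]
      · intro i _ hi
        rw [mul_assoc, hf.mul_eq, if_neg hi, mul_zero]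
      · simp
    rw [h1]
    simp only [h2, ← Finset.sum_mul, he.sum_eq, one_mul, hf.sum_eq]
  refine ⟨⟨s, Unitary.mem_iff.2 ⟨by rw [hstar, hss], by rw [hstar, hss]⟩⟩, fun i j => ?_⟩
  change f i j = s * e i j * star s
  rw [hse, ← hfs, hstar, mul_assoc, hss, mul_one]

variable {D : Type u} [CStarAlgebra D]

/-- A chain of equivalences: `θ` to a conjugate near `α ∘ θ`, to `α ∘ θ` by perturbation, to `β ∘
θ'` by the flip. -/
theorem TensorSquare.exists_conj_eq_beta (S : TensorSquare D) {n : ℕ}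
    (θ θ' : Matrix (Fin n) (Fin n) ℂ →⋆ₐ[ℂ] D) :
    ∃ w : unitary D, ∀ i j, S.β (θ' (Matrix.single i j 1)) =
      w * θ (Matrix.single i j 1) * star (w : D) := by
  rcases Nat.eq_zero_or_pos n with rfl | hn
  · exact ⟨1, fun i => i.elim0⟩
  have hn' : (0 : ℝ) < n := by exact_mod_cast hn
  set o : Fin n := ⟨0, hn⟩
  have hev : ∀ᶠ m in atTop, ∀ i : Fin n, ‖(S.w m : D) * θ (Matrix.single o i 1) *
      star (S.w m : D) - S.α (θ (Matrix.single o i 1))‖ < 1 / (6 * n) :=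
    Filter.eventually_all.2 fun i =>
      (S.tendsto (θ (Matrix.single o i 1))).eventually (gt_mem_nhds (by positivity))
  obtain ⟨m, hm⟩ := hev.exists
  -- The tolerance `1 / (6 n)` is the largest that the perturbation lemma admits.
  obtain ⟨u, -, hu⟩ := ((isMatrixUnits_map_single θ).map S.α).exists_unitary_conj
    (isMatrixUnits_map_single (StarAlgHom.conj (S.w m) θ)) o (δ := 1 / (6 * n))
    (by rw [Fintype.card_fin]; field_simp; exact le_rfl) (fun i => (hm i).le)
  obtain ⟨s, hs⟩ := exists_flip_unitary ((isMatrixUnits_map_single θ).map S.α)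
    ((isMatrixUnits_map_single θ').map S.β) (fun _ _ _ _ => S.commute _ _)
  refine ⟨s * u * S.w m, fun i j => ?_⟩
  rw [hs, hu, StarAlgHom.conj_apply]
  simp only [Submonoid.coe_mul, star_mul, mul_assoc]

/-- Both maps are equivalent to the same `β ∘ θ`, which serves as intermediary. -/
theorem TensorSquare.exists_conj_eq (S : TensorSquare D) {n : ℕ}
    (θ θ' : Matrix (Fin n) (Fin n) ℂ →⋆ₐ[ℂ] D) : ∃ w : unitary D, θ' = StarAlgHom.conj w θ := by
  obtain ⟨w, hw⟩ := S.exists_conj_eq_beta θ θ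
  obtain ⟨w', hw'⟩ := S.exists_conj_eq_beta θ' θ
  refine ⟨star w' * w, matrix_starAlgHom_ext fun i j => ?_⟩
  have h1 : θ' (Matrix.single i j 1) = star (w' : D) *
      (w' * θ' (Matrix.single i j 1) * star (w' : D)) * w' := by
    have h2 := Unitary.coe_star_mul_self w'
    calc _ = (star (w' : D) * w') * θ' (Matrix.single i j 1) * (star (w' : D) * w') := by
          rw [h2, one_mul, mul_one]
      _ = _ := by simp only [mul_assoc]
  rw [h1, ← hw', hw, StarAlgHom.conj_apply]
  simp only [Submonoid.coe_mul, Unitary.coe_star, star_mul, star_star, mul_assoc]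

end Uniqueness

/-! ### Embeddings of matrix algebras from divisibility of the unit -/

section Divisibility

variable {D : Type u} [Ring D] [StarRing D]

/-- The class of a projection in the Murray-von Neumann monoid. -/
def MatrixProjection.toMonoid (p : MatrixProjection D) : MurrayVonNeumannMonoid D :=
  Quotient.mk _ p

/-- By induction `q ∼ r ⊕ p` with `[r] = n • [p]`: the partial isometries for `r`, together with `p`
itself, are placed as columns in the block sum and pulled back along the equivalence. -/
theorem exists_isometries_of_eq_nsmul (p : MatrixProjection D) (n : ℕ) (q : MatrixProjection D)
    (h : q.toMonoid = n • p.toMonoid) :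
    ∃ v : Fin n → Matrix (Fin q.size) (Fin p.size) D,
      (∀ i j, (v i)ᴴ * v j = if i = j then p.mat else 0) ∧ ∑ i, v i * (v i)ᴴ = q.mat := by
  induction n generalizing q with
  | zero =>
    rw [zero_nsmul] at h
    obtain ⟨w, hw, -⟩ : MurrayVonNeumann q.mat (0 : Matrix (Fin 0) (Fin 0) D) :=
      Quotient.exact h
    refine ⟨fun i => i.elim0, fun i => i.elim0, ?_⟩
    rw [← hw]
    ext i j
    simp [Matrix.mul_apply]
  | succ n ih =>
    rw [succ_nsmul] at h
    obtain ⟨r, hr⟩ : ∃ r : MatrixProjection D, r.toMonoid = n • p.toMonoid :=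
      Quotient.exists_rep (n • p.toMonoid)
    obtain ⟨v, hv, hvs⟩ := ih r hr
    rw [← hr] at h
    have hqr : MurrayVonNeumann q.mat (r.directSum p).mat := Quotient.exact h
    have hp : p.mat * p.mat = p.mat := p.isProj.isIdempotentElem
    have hps : p.matᴴ = p.mat := p.isProj.isSelfAdjoint
    have hq : q.mat * q.mat = q.mat := q.isProj.isIdempotentElem
    obtain ⟨w, hw, hw'⟩ := hqr.trans q.isProj (r.isProj.matrix_fromBlocks p.isProj)
      (r.directSum_equiv p).symm
    have hrv : ∀ j, r.mat * v j = v j * p.mat := fun j => by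
      rw [← hvs, Matrix.sum_mul, Finset.sum_eq_single j]
      · rw [Matrix.mul_assoc, hv, if_pos rfl]
      · intro i _ hi
        rw [Matrix.mul_assoc, hv, if_neg hi, Matrix.mul_zero]
      · simp
    obtain ⟨f, hf⟩ : ∃ f : Matrix (Fin r.size ⊕ Fin p.size) (Fin p.size) D →
        Matrix (Fin q.size) (Fin p.size) D, ∀ a, f a = wᴴ * a := ⟨_, fun _ => rfl⟩
    -- Pulling back preserves products `aᴴ * b` once `r ⊕ p` fixes `b`, as it does for the columns
    -- used below.
    have key : ∀ {a b : Matrix (Fin r.size ⊕ Fin p.size) (Fin p.size) D},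
        (f a)ᴴ * f b = aᴴ * (Matrix.fromBlocks r.mat 0 0 p.mat * b) := by
      intro a b
      rw [← hw', hf, hf]
      simp only [Matrix.conjTranspose_mul, Matrix.conjTranspose_conjTranspose, Matrix.mul_assoc]
    refine ⟨Fin.cons (f (Matrix.fromRows 0 p.mat)) fun i => f (Matrix.fromRows (v i) 0), ?_, ?_⟩
    · refine Fin.cases (Fin.cases ?_ fun j => ?_) fun i => Fin.cases ?_ fun j => ?_
      · simp only [Fin.cons_zero, if_true]
        rw [key, Matrix.fromBlocks_mul_fromRows,
          Matrix.conjTranspose_fromRows_eq_fromCols_conjTranspose,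
          Matrix.fromCols_mul_fromRows]
        simp [hp, hps]
      · simp only [Fin.cons_zero, Fin.cons_succ]
        rw [key, Matrix.fromBlocks_mul_fromRows,
          Matrix.conjTranspose_fromRows_eq_fromCols_conjTranspose,
          Matrix.fromCols_mul_fromRows]
        simp [(Fin.succ_ne_zero j).symm]
      · simp only [Fin.cons_zero, Fin.cons_succ]
        rw [key, Matrix.fromBlocks_mul_fromRows,
          Matrix.conjTranspose_fromRows_eq_fromCols_conjTranspose,
          Matrix.fromCols_mul_fromRows]
        simp
      · simp only [Fin.cons_succ, Fin.succ_inj]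
        rw [key, Matrix.fromBlocks_mul_fromRows,
          Matrix.conjTranspose_fromRows_eq_fromCols_conjTranspose,
          Matrix.fromCols_mul_fromRows]
        simp only [Matrix.zero_mul, Matrix.mul_zero, add_zero, Matrix.conjTranspose_zero, hrv,
          ← Matrix.mul_assoc, hv]
        split_ifs
        · exact hp
        · exact Matrix.zero_mul _
    · rw [Fin.sum_univ_succ]
      simp only [Fin.cons_zero, Fin.cons_succ]
      have h1 : ∀ a : Matrix (Fin r.size ⊕ Fin p.size) (Fin p.size) D,
          f a * (f a)ᴴ = wᴴ * (a * aᴴ) * w := fun a => by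
        simp only [hf, Matrix.conjTranspose_mul, Matrix.conjTranspose_conjTranspose,
          Matrix.mul_assoc]
      have h2 : Matrix.fromRows (0 : Matrix (Fin r.size) (Fin p.size) D) p.mat *
          (Matrix.fromRows (0 : Matrix (Fin r.size) (Fin p.size) D) p.mat)ᴴ +
          ∑ i, Matrix.fromRows (v i) (0 : Matrix (Fin p.size) (Fin p.size) D) *
            (Matrix.fromRows (v i) (0 : Matrix (Fin p.size) (Fin p.size) D))ᴴ =
          Matrix.fromBlocks r.mat 0 0 p.mat := by
        simp only [Matrix.conjTranspose_fromRows_eq_fromCols_conjTranspose,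
          Matrix.fromRows_mul_fromCols]
        ext (i | i) (j | j) <;> simp [Matrix.sum_apply, ← hvs, hp, hps]
      simp only [h1]
      rw [← Matrix.sum_mul, ← Matrix.mul_sum, ← Matrix.add_mul, ← Matrix.mul_add, h2, ← hw',
        Matrix.mul_assoc, Matrix.mul_assoc, hw, ← Matrix.mul_assoc, hw, hq]

/-- Equality in the Grothendieck group means equality after adding a common class, which
cancellation removes. -/
theorem toMonoid_eq_of_of_eq (hcancel : HasCancellationOfProjections D)
    {x y : MurrayVonNeumannMonoid D}
    (h : Algebra.GrothendieckAddGroup.of x = Algebra.GrothendieckAddGroup.of y) : x = y := by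
  obtain ⟨⟨c, _⟩, hc⟩ := (AddLocalization.addMonoidOf
    (⊤ : AddSubmonoid (MurrayVonNeumannMonoid D))).exists_of_eq h
  replace hc : x + c = y + c := by rw [add_comm x, add_comm y]; exact hc
  obtain ⟨p, rfl⟩ := Quotient.exists_rep x
  obtain ⟨q, rfl⟩ := Quotient.exists_rep y
  obtain ⟨r, rfl⟩ := Quotient.exists_rep c
  exact Quotient.sound (hcancel p q r (Quotient.exact hc))

/-- The unit has size `1`, so the partial isometries are rows over `D`, and the products `v i * (v
j)ᴴ` are `1 × 1` matrices, that is, matrix units in `D`. -/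
theorem exists_matrix_starAlgHom_of_divisible {D : Type u} [CStarAlgebra D]
    (hcancel : HasCancellationOfProjections D) {n : ℕ}
    (hdiv : ∃ x ∈ KZero.positiveCone D, KZero.classOf (MatrixProjection.unit D) = n • x) :
    Nonempty (Matrix (Fin n) (Fin n) ℂ →⋆ₐ[ℂ] D) := by
  obtain ⟨_, ⟨p, rfl⟩, hp⟩ := hdiv
  have h : (MatrixProjection.unit D).toMonoid = n • p.toMonoid :=
    toMonoid_eq_of_of_eq hcancel (by rw [map_nsmul]; exact hp)
  obtain ⟨v, hv, hvs⟩ : ∃ v : Fin n → Matrix (Fin 1) (Fin p.size) D,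
      (∀ i j, (v i)ᴴ * v j = if i = j then p.mat else 0) ∧ ∑ i, v i * (v i)ᴴ = 1 :=
    exists_isometries_of_eq_nsmul p n _ h
  have hvp : ∀ j, v j * p.mat = v j := fun j => by
    conv_rhs => rw [← Matrix.one_mul (v j), ← hvs, Matrix.sum_mul]
    rw [Finset.sum_eq_single j]
    · rw [Matrix.mul_assoc, hv, if_pos rfl]
    · intro i _ hi
      rw [Matrix.mul_assoc, hv, if_neg hi, Matrix.mul_zero]
    · simp
  have hmul : ∀ a b : Matrix (Fin 1) (Fin 1) D, a 0 0 * b 0 0 = (a * b) 0 0 := fun a b => by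
    simp [Matrix.mul_apply]
  have he : IsMatrixUnits fun i j : Fin n => (v i * (v j)ᴴ) 0 0 :=
    { mul_eq := fun i j k l => by
        rw [hmul, Matrix.mul_assoc, ← Matrix.mul_assoc (v j)ᴴ, hv]
        split_ifs
        · rw [← Matrix.mul_assoc, hvp]
        · simp
      star_eq := fun i j => by
        rw [← Matrix.conjTranspose_apply, Matrix.conjTranspose_mul,
          Matrix.conjTranspose_conjTranspose]
      sum_eq := by rw [← Matrix.sum_apply, hvs, Matrix.one_apply_eq] }
  exact ⟨he.hom⟩

end Divisibility

/-! ### Local approximation of `D` itself -/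

theorem TensorSquare.exists_hom_near {D : Type u} [CStarAlgebra D] (S : TensorSquare D)
    (hex : ∀ n : ℕ, 1 ≤ n → Nonempty (Matrix (Fin n) (Fin n) ℂ →⋆ₐ[ℂ] D))
    (hS : ∀ (F : Finset D) (ε : ℝ), 0 < ε → ∃ l : ℕ, 1 ≤ l ∧
      ∀ θ : Matrix (Fin l) (Fin l) ℂ →⋆ₐ[ℂ] D, ∃ v : unitary D, ∀ d ∈ F, ∃ a,
        ‖(v : D) * S.α d * star (v : D) - S.β (θ a)‖ ≤ ε)
    (F : Finset D) {ε : ℝ} (hε : 0 < ε) :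
    ∃ (l : ℕ) (θ : Matrix (Fin l) (Fin l) ℂ →⋆ₐ[ℂ] D), ∀ d ∈ F, ∃ a, ‖θ a - d‖ ≤ ε := by
  obtain ⟨l, hl, h⟩ := hS F (ε / 2) (half_pos hε)
  obtain ⟨θ⟩ := hex l hl
  obtain ⟨v, hv⟩ := h θ
  have hev : ∀ᶠ m in atTop, ∀ d ∈ F, ‖(S.w m : D) * d * star (S.w m : D) - S.α d‖ < ε / 2 :=
    (Filter.eventually_all_finset F).2 fun d _ =>
      (S.tendsto d).eventually (gt_mem_nhds (half_pos hε))
  obtain ⟨m, hm⟩ := hev.exists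
  -- `w m` takes `d` near `α d` and `v` takes that near `β (θ a)`, each within `ε / 2`; conjugating
  -- back puts a copy of the matrix algebra near `d`.
  refine ⟨l, StarAlgHom.conj (star (v * S.w m)) (S.β.comp θ), fun d hd => ?_⟩
  obtain ⟨a, ha⟩ := hv d hd
  refine ⟨a, ?_⟩
  set u : unitary D := v * S.w m with hu
  have h1 : StarAlgHom.conj (star u) (S.β.comp θ) a - d =
      (star u : unitary D) * (S.β (θ a) - u * d * star (u : D)) * (u : D) := by
    have h2 := Unitary.coe_star_mul_self u
    rw [StarAlgHom.conj_apply, mul_sub, sub_mul, Unitary.coe_star, star_star]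
    congr 1
    calc d = (star (u : D) * u) * d * (star (u : D) * u) := by rw [h2, one_mul, mul_one]
      _ = _ := by simp only [mul_assoc]
  have h3 : S.β (θ a) - u * d * star (u : D) =
      -((v * S.α d * star (v : D) - S.β (θ a)) +
        v * (S.w m * d * star (S.w m : D) - S.α d) * (star v : unitary D)) := by
    rw [hu, Submonoid.coe_mul, star_mul, Unitary.coe_star]
    noncomm_ring
  rw [h1, CStarRing.norm_mul_coe_unitary, CStarRing.norm_coe_unitary_mul, h3, norm_neg]
  refine (norm_add_le _ _).trans ?_
  rw [CStarRing.norm_mul_coe_unitary, CStarRing.norm_coe_unitary_mul]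
  linarith [hm d hd]

end

theorem proposition2p9 {D : Type u} [CStarAlgebra D] [Nontrivial D]
    [TopologicalSpace.SeparableSpace D]
    (hssa : IsStronglySelfAbsorbing D)
    (hqd : IsQuasidiagonal D)
    (hcancel : HasCancellationOfProjections D)
    (hdiv : ∀ n : ℕ, 1 ≤ n →
      ∃ x ∈ KZero.positiveCone D, KZero.classOf (MatrixProjection.unit D) = n • x) :
    Nonempty (D ≃⋆ₐ[ℂ] universalUHF) := by
  obtain ⟨S, hS⟩ := exists_tensorSquare_approx hssa hqd
  have hex : ∀ n : ℕ, 1 ≤ n → Nonempty (Matrix (Fin n) (Fin n) ℂ →⋆ₐ[ℂ] D) := fun n hn =>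
    exists_matrix_starAlgHom_of_divisible hcancel (hdiv n hn)
  exact nonempty_starAlgEquiv_universalUHF hex (fun _ θ θ' => S.exists_conj_eq θ θ')
    fun F _ hε => S.exists_hom_near hex hS F hε
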